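/- An $(a:b)$ Avoider–Enforcer game under the \emph{monotone} rules is played on a finite board $X$ with a family $\mathcal F$ of target sets $F\subseteq X$: Avoider, who moves first, and Enforcer alternately claim previously unclaimed elements of $X$, Avoider at least $a$ and Enforcer at least $b$ per move (a player facing fewer unclaimed elements than his bias claims all of them), until every element is claimed. Avoider loses if in the end he has claimed all elements of some $F\in\mathcal F$; otherwise he wins. The monotone threshold bias $f^{mon}_{\mathcal F}$ is the non-negative integer such that, for every integer $b\ge 1$, Enforcer wins the monotone $(1:b)$ game if and only if $b\le f^{mon}_{\mathcal F}$. For a fixed graph $H$, let $\mathcal K_H=\mathcal K_H(n)$ be the game whose board is $E(K_n)$ and whose target sets are the edge sets of all copies of $H$ in $K_n$. For $k\ge 3$, let the double star $\mathcal S_{k,k}$ be the graph on the $2k$ vertices $u,u_1,\dots,u_{k-1},v,v_1,\dots,v_{k-1}$ with edges $uv$ and $uu_i$, $vv_i$ for $1\le i\le k-1$, and let the path double star $\mathcal{PS}_{k,k}$ be the graph on the $2k+1$ vertices $w,u,u_1,\dots,u_{k-1},v,v_1,\dots,v_{k-1}$ with edges $uw$, $vw$ and $uu_i$, $vv_i$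 for $1\le i\le k-1$. \textbf{Theorem.} Let $k\ge 3$ be a fixed integer. Then the monotone threshold biases of the games $\mathcal K_{\mathcal S_{k,k}}$ and $\mathcal K_{\mathcal{PS}_{k,k}}$ on $E(K_n)$ exist for every $n$, and, as $n\to\infty$, (i) $f^{mon}_{\mathcal K_{\mathcal S_{k,k}}}=\Theta\bigl(n^{k/(k-1)}\bigr)$; (ii) $f^{mon}_{\mathcal K_{\mathcal{PS}_{k,k}}}=\Theta\bigl(n^{(k+1)/k}\bigr)$, where the implied constants may depend on $k$. -/

import Mathlib

open Filter Asymptotics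

/-- `IsMonotoneMove q U S`: under the monotone rules with bias `q`, a player facing the set `U` of
unclaimed elements may claim the set `S`: it consists of at least `q` unclaimed elements, or of all
of them if fewer than `q` are left. -/
def IsMonotoneMove {α : Type*} (q : ℕ) (U S : Finset α) : Prop :=
  S ⊆ U ∧ (q ≤ S.card ∨ S = U)

/-- `EnforcerWinsFrom 𝓕 a b A U`: Enforcer has a winning strategy in the monotone `(a : b)`
Avoider-Enforcer game with target sets `𝓕`, from the position in which Avoider has claimed `A`, the
set of unclaimed elements is `U`, and Avoider is to move.  When nothing is left, Enforcer has won
iff Avoider has claimed all of some target set.  Otherwise Enforcer needs an answer `T S` to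
every possible move `S` of Avoider, after which he still has a winning strategy. -/
inductive EnforcerWinsFrom {α : Type*} [DecidableEq α] (𝓕 : Set (Finset α)) (a b : ℕ) :
    Finset α → Finset α → Prop
  | ended (A F : Finset α) (hF : F ∈ 𝓕) (hFA : F ⊆ A) : EnforcerWinsFrom 𝓕 a b A ∅
  | round (A U : Finset α) (hU : U.Nonempty) (T : Finset α → Finset α)
      (hT : ∀ S, IsMonotoneMove a U S → IsMonotoneMove b (U \ S) (T S))
      (hwin : ∀ S, IsMonotoneMove a U S → EnforcerWinsFrom 𝓕 a b (A ∪ S) ((U \ S) \ T S)) :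
      EnforcerWinsFrom 𝓕 a b A U

/-- Enforcer wins the monotone `(a : b)` game with board `X` and target sets `𝓕`;
Avoider plays first. -/
def EnforcerWinsMonotone {α : Type*} [DecidableEq α] (X : Finset α) (𝓕 : Set (Finset α))
    (a b : ℕ) : Prop :=
  EnforcerWinsFrom 𝓕 a b ∅ X

/-- `f` is the monotone threshold bias of the game with board `X` and target sets `𝓕`: for every
(positive) bias `b`, Enforcer wins the monotone `(1 : b)` game iff `b ≤ f`.  There is at most one
such `f`. -/
def IsMonotoneThresholdBias {α : Type*} [DecidableEq α] (X : Finset α) (𝓕 : Set (Finset α))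
    (f : ℕ) : Prop :=
  ∀ b : ℕ, 1 ≤ b → (EnforcerWinsMonotone X 𝓕 1 b ↔ b ≤ f)

/-- The edge set of the complete graph `K_n`. -/
def completeBoard (n : ℕ) : Finset (Sym2 (Fin n)) :=
  (⊤ : SimpleGraph (Fin n)).edgeFinset

/-- The edge sets of all copies of the graph `H` in `K_n`. -/
def copiesInComplete {W : Type*} (H : SimpleGraph W) (n : ℕ) : Set (Finset (Sym2 (Fin n))) :=
  {F | ∃ φ : W ↪ Fin n, (F : Set (Sym2 (Fin n))) = Sym2.map φ '' H.edgeSet}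

/-- The vertices `u, u₁, …, u_{k-1}, v, v₁, …, v_{k-1}` of the double star. -/
inductive DoubleStarVertex (k : ℕ) : Type
  | u : DoubleStarVertex k
  | v : DoubleStarVertex k
  | uLeaf (i : Fin (k - 1)) : DoubleStarVertex k
  | vLeaf (i : Fin (k - 1)) : DoubleStarVertex k

/-- The double star `S_{k,k}`: edges `uv`, `u u_i`, `v v_i`. -/
def doubleStar (k : ℕ) : SimpleGraph (DoubleStarVertex k) :=
  SimpleGraph.fromEdgeSet
    ({s(DoubleStarVertex.u, DoubleStarVertex.v)} ∪
      Set.range (fun i => s(DoubleStarVertex.u, DoubleStarVertex.uLeaf i)) ∪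
      Set.range (fun i => s(DoubleStarVertex.v, DoubleStarVertex.vLeaf i)))

/-- The vertices `w, u, u₁, …, u_{k-1}, v, v₁, …, v_{k-1}` of the path double star. -/
inductive PathDoubleStarVertex (k : ℕ) : Type
  | w : PathDoubleStarVertex k
  | u : PathDoubleStarVertex k
  | v : PathDoubleStarVertex k
  | uLeaf (i : Fin (k - 1)) : PathDoubleStarVertex k
  | vLeaf (i : Fin (k - 1)) : PathDoubleStarVertex k

/-- The path double star `PS_{k,k}`: edges `u w`, `v w`, `u u_i`, `v v_i`. -/
def pathDoubleStar (k : ℕ) : SimpleGraph (PathDoubleStarVertex k) :=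
  SimpleGraph.fromEdgeSet
    ({s(PathDoubleStarVertex.u, PathDoubleStarVertex.w),
        s(PathDoubleStarVertex.v, PathDoubleStarVertex.w)} ∪
      Set.range (fun i => s(PathDoubleStarVertex.u, PathDoubleStarVertex.uLeaf i)) ∪
      Set.range (fun i => s(PathDoubleStarVertex.v, PathDoubleStarVertex.vLeaf i)))

/-! Both games have thresholds of order `n ^ ((L + 2) / (L + 1))`, where `L` is the largest degree
bound Avoider may keep and still afford one arbitrary last edge. For the double star `L = k - 2`:
one more edge leaves all degrees below `k`. For the path double star `L = k - 1`: one more edge can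
lift two vertices to degree `k`, but these are adjacent through it, whereas the two centres are not
joined by an edge of the target.

Avoider's side (`not_enforcerWinsMonotone_of_bounded_degree`): he plays in stages, at stage `i` only
edges whose endpoints have degree at most `i`. Each round creates at most two vertices of degree `i
+ 1` and costs Enforcer at least `b` edges, so few such vertices arise. When Avoider is stuck they
cover all unclaimed edges, of which there are at most `n` per vertex; each stage thus shrinks the
bound on the unclaimed edges by a factor `2 * n / b`. After `L` stages at most `b` edges are left,
and Avoider takes just one of them.

Enforcer's side (`enforcerWinsMonotone_of_isForceable`): he keeps a set `Z` of vertices with no edge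
at `Z` claimed by him, and takes every other edge, so each edge of Avoider raises a degree in `Z`.
Giving up `t` vertices of `Z` yields about `t * n / 2` edges, enough for a move with `b` of order `t
* n`. Abandoning vertices of lowest degree, he drives the minimum degree in `Z` up; each level costs
a factor of order `t` in `|Z|`, so `t` of order `n ^ (1 / (L + 1))` can be afforded. Avoider cannot
have many vertices of degree `L + 1` in `Z` unless some edge at `Z` would complete a target, and
Enforcer then leaves him exactly that edge. `IsForceable` isolates what this needs from the targets.
-/

/-! ### Monotone games: existence of the threshold and winning by invariants -/

section Game

variable {α : Type*} {𝓕 : Set (Finset α)} {a b : ℕ}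

theorem IsMonotoneMove.mono {q q' : ℕ} (hq : q ≤ q') {U S : Finset α}
    (h : IsMonotoneMove q' U S) : IsMonotoneMove q U S :=
  ⟨h.1, h.2.imp_left hq.trans⟩

theorem isMonotoneMove_self (q : ℕ) (U : Finset α) : IsMonotoneMove q U U :=
  ⟨subset_rfl, Or.inr rfl⟩

theorem IsMonotoneMove.nonempty {U S : Finset α} (hU : U.Nonempty)
    (h : IsMonotoneMove 1 U S) : S.Nonempty := by
  rcases h.2 with h | rfl
  · exact Finset.card_pos.1 h
  · exact hU

variable [DecidableEq α]

theorem EnforcerWinsFrom.mono_bias {b' : ℕ} (hb : b ≤ b') {A U : Finset α}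
    (h : EnforcerWinsFrom 𝓕 a b' A U) : EnforcerWinsFrom 𝓕 a b A U := by
  induction h with
  | ended A F hF hFA => exact .ended A F hF hFA
  | round A U hU T hT _ ih => exact .round A U hU T (fun S hS => (hT S hS).mono hb) ih

/-- A legal answer for a larger bias is legal for a smaller one, so the biases with which Enforcer
wins are closed downwards; one loss bounds them. -/
theorem exists_isMonotoneThresholdBias {X : Finset α} {b₀ : ℕ} (hb₀ : 1 ≤ b₀)
    (h : ¬ EnforcerWinsMonotone X 𝓕 1 b₀) : ∃ f, IsMonotoneThresholdBias X 𝓕 f := by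
  classical
  have hex : ∃ b, 1 ≤ b ∧ ¬ EnforcerWinsMonotone X 𝓕 1 b := ⟨b₀, hb₀, h⟩
  refine ⟨Nat.find hex - 1, fun b hb => ⟨fun hw => ?_, fun hle => ?_⟩⟩
  · by_contra hlt
    exact (Nat.find_spec hex).2 (EnforcerWinsFrom.mono_bias (by omega) hw)
  · by_contra hw
    have := Nat.find_min' hex ⟨hb, hw⟩
    have := (Nat.find_spec hex).1
    omega

theorem not_enforcerWinsFrom_of_invariant (P : Finset α → Finset α → Prop)
    (hend : ∀ A, P A ∅ → ∀ F ∈ 𝓕, ¬ F ⊆ A)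
    (hstep : ∀ A U, U.Nonempty → P A U → ∃ S, IsMonotoneMove a U S ∧
      ∀ T, IsMonotoneMove b (U \ S) T → P (A ∪ S) ((U \ S) \ T))
    {A U : Finset α} (hP : P A U) : ¬ EnforcerWinsFrom 𝓕 a b A U := by
  intro h
  induction h with
  | ended A F hF hFA => exact hend A hP F hF hFA
  | round A U hU T hT _ ih =>
    obtain ⟨S, hS, hS'⟩ := hstep A U hU hP
    exact ih S hS (hS' _ (hT S hS))

/-- Enforcer wins from every position from which he can answer every move of Avoider so that he
either wins for another reason or stays in the set of positions `P`. -/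
theorem enforcerWinsFrom_of_invariant (P : Finset α → Finset α → Prop)
    (hend : ∀ A, P A ∅ → ∃ F ∈ 𝓕, F ⊆ A)
    (hstep : ∀ A U, U.Nonempty → P A U → ∀ S, IsMonotoneMove 1 U S →
      ∃ T, IsMonotoneMove b (U \ S) T ∧
        (EnforcerWinsFrom 𝓕 1 b (A ∪ S) ((U \ S) \ T) ∨ P (A ∪ S) ((U \ S) \ T)))
    {A U : Finset α} (hP : P A U) : EnforcerWinsFrom 𝓕 1 b A U := by
  classical
  induction hn : U.card using Nat.strong_induction_on generalizing A U with
  | _ m ih =>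
    rcases U.eq_empty_or_nonempty with rfl | hU
    · obtain ⟨F, hF, hFA⟩ := hend A hP
      exact .ended A F hF hFA
    · choose! T hT hT' using hstep A U hU hP
      refine .round A U hU T hT fun S hS => ?_
      rcases hT' S hS with h | h
      · exact h
      · refine ih _ ?_ h rfl
        have h1 : ((U \ S) \ T S).card ≤ (U \ S).card := Finset.card_le_card Finset.sdiff_subset
        have h2 : (U \ S).card < U.card := by
          refine Finset.card_lt_card ⟨Finset.sdiff_subset, fun h => ?_⟩
          obtain ⟨x, hx⟩ := hS.nonempty hU
          exact (Finset.mem_sdiff.1 (h (hS.1 hx))).2 hx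
        omega

theorem enforcerWinsFrom_of_subset {A U F : Finset α} (hF : F ∈ 𝓕) (hFA : F ⊆ A) :
    EnforcerWinsFrom 𝓕 a b A U := by
  rcases U.eq_empty_or_nonempty with rfl | hU
  · exact .ended A F hF hFA
  · refine .round A U hU (fun S => U \ S) (fun S _ => isMonotoneMove_self _ _) fun S _ => ?_
    simp only [Finset.sdiff_self]
    exact .ended _ F hF (hFA.trans Finset.subset_union_left)

theorem enforcerWinsFrom_singleton {A F : Finset α} {e : α} (hF : F ∈ 𝓕) (hFA : F ⊆ insert e A) :
    EnforcerWinsFrom 𝓕 1 b A {e} := by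
  refine .round A {e} (Finset.singleton_nonempty e) (fun S => {e} \ S)
    (fun S _ => isMonotoneMove_self _ _) fun S hS => ?_
  have hSe : S = {e} := by
    rcases Finset.subset_singleton_iff.1 hS.1 with rfl | h
    · exact absurd (hS.nonempty (Finset.singleton_nonempty e)) (by simp)
    · exact h
  subst hSe
  simp only [Finset.sdiff_self]
  refine .ended _ F hF (hFA.trans ?_)
  rw [Finset.insert_eq, Finset.union_comm]

/-- If some edge would complete a target and more than `b` edges are unclaimed, then Enforcer, who
is to move, wins by leaving that edge to Avoider. -/
theorem exists_winning_answer {A U F : Finset α} {e : α} (hF : F ∈ 𝓕) (hFA : F ⊆ insert e A)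
    (he : e ∈ A ∪ U) (hU : b + 1 ≤ U.card) :
    ∃ T, IsMonotoneMove b U T ∧ EnforcerWinsFrom 𝓕 1 b A (U \ T) := by
  by_cases heA : e ∈ A
  · rw [Finset.insert_eq_of_mem heA] at hFA
    exact ⟨U, isMonotoneMove_self _ _, enforcerWinsFrom_of_subset hF hFA⟩
  · have heU : e ∈ U := (Finset.mem_union.1 he).resolve_left heA
    refine ⟨U.erase e, ⟨Finset.erase_subset _ _, Or.inl ?_⟩, ?_⟩
    · rw [Finset.card_erase_of_mem heU]
      omega
    · have : U \ U.erase e = {e} := by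
        ext x
        simp only [Finset.mem_sdiff, Finset.mem_erase, Finset.mem_singleton]
        grind
      rw [this]
      exact enforcerWinsFrom_singleton hF hFA

end Game

/-! ### Avoider's strategy: keeping degrees bounded in stages -/

section Avoider

variable {n : ℕ}

theorem mem_completeBoard {e : Sym2 (Fin n)} : e ∈ completeBoard n ↔ ¬ e.IsDiag := by
  simp [completeBoard]

theorem mk_mem_completeBoard {x y : Fin n} : s(x, y) ∈ completeBoard n ↔ x ≠ y := by
  simp [mem_completeBoard]

theorem two_mul_card_completeBoard_le (n : ℕ) : 2 * (completeBoard n).card ≤ n ^ 2 := by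
  have h : (completeBoard n).card = n.choose 2 := by
    have := SimpleGraph.card_edgeFinset_top_eq_card_choose_two (V := Fin n)
    rw [Fintype.card_fin] at this
    rw [← this, completeBoard]
  rw [h, Nat.choose_two_right]
  have := Nat.mul_div_le (n * (n - 1)) 2
  nlinarith [Nat.mul_le_mul_left n (Nat.sub_le n 1)]

/-- The number of elements of `A` incident with the vertex `v`. -/
def incidenceDegree (A : Finset (Sym2 (Fin n))) (v : Fin n) : ℕ :=
  (A.filter (v ∈ ·)).card

theorem incidenceDegree_union_singleton_le (A : Finset (Sym2 (Fin n))) (e : Sym2 (Fin n))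
    (v : Fin n) :
    incidenceDegree (A ∪ {e}) v ≤ incidenceDegree A v + if v ∈ e then 1 else 0 := by
  unfold incidenceDegree
  rw [Finset.filter_union, Finset.filter_singleton]
  refine (Finset.card_union_le _ _).trans ?_
  split_ifs <;> simp

theorem card_filter_mem_sym2_le (e : Sym2 (Fin n)) :
    (Finset.univ.filter (· ∈ e)).card ≤ 2 := by
  induction e with
  | _ x y =>
    refine (Finset.card_le_card (t := {x, y}) fun z hz => ?_).trans Finset.card_le_two
    simpa using hz

/-- The position of Avoider's strategy in which all his degrees are at most `i + 1`; the bound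
controls the number of vertices of degree `i + 1` and of unclaimed edges. -/
def AvoiderStage (b : ℕ) (A U : Finset (Sym2 (Fin n))) (i : ℕ) : Prop :=
  (∀ v, incidenceDegree A v ≤ i + 1) ∧
    b ^ i * (b * (Finset.univ.filter fun v => incidenceDegree A v = i + 1).card + 2 * U.card) ≤
      n ^ 2 * (2 * n) ^ i

theorem card_le_of_forall_exists_mem (U : Finset (Sym2 (Fin n))) (P : Fin n → Prop)
    [DecidablePred P] (h : ∀ e ∈ U, ∃ v ∈ e, P v) :
    U.card ≤ (Finset.univ.filter P).card * n := by
  calc U.card ≤ (((Finset.univ.filter P) ×ˢ (Finset.univ : Finset (Fin n))).image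
        fun p => s(p.1, p.2)).card := by
        refine Finset.card_le_card fun e he => ?_
        obtain ⟨v, hv, hP⟩ := h e he
        obtain ⟨w, rfl⟩ := hv
        exact Finset.mem_image.2 ⟨(v, w), by simp [hP], rfl⟩
    _ ≤ _ := Finset.card_image_le
    _ = _ := by simp

/-- Avoider is stuck: the saturated vertices cover `U`, so `U.card` is at most `n` times their
number, which the stage bounds. -/
theorem AvoiderStage.card_le {b i : ℕ} {A U : Finset (Sym2 (Fin n))} (h : AvoiderStage b A U i)
    (hU : ∀ e ∈ U, ∃ v ∈ e, i + 1 ≤ incidenceDegree A v) :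
    b ^ (i + 1) * (2 * U.card) ≤ n ^ 2 * (2 * n) ^ (i + 1) := by
  have h1 := card_le_of_forall_exists_mem U (fun v => incidenceDegree A v = i + 1)
    fun e he => by
      obtain ⟨v, hv, hd⟩ := hU e he
      exact ⟨v, hv, le_antisymm (h.1 v) hd⟩
  set N := (Finset.univ.filter fun v => incidenceDegree A v = i + 1).card
  calc b ^ (i + 1) * (2 * U.card) ≤ b ^ (i + 1) * (2 * (N * n)) := by gcongr
    _ = (b ^ i * (b * N)) * (2 * n) := by ring
    _ ≤ (b ^ i * (b * N + 2 * U.card)) * (2 * n) := by gcongr; omega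
    _ ≤ (n ^ 2 * (2 * n) ^ i) * (2 * n) := Nat.mul_le_mul_right _ h.2
    _ = _ := by ring

/-- A stuck Avoider passes to the next stage, perhaps several times in a row; a new stage starts
with no saturated vertex, so its bound is exactly the one on unclaimed edges just obtained. `m`
counts the stages still available. -/
theorem AvoiderStage.exists_playable {b L : ℕ} {A U : Finset (Sym2 (Fin n))}
    (hb : 2 ^ L * n ^ (L + 2) ≤ b ^ (L + 1)) (hb0 : 0 < b) (m : ℕ) :
    ∀ i, i + m + 1 = L → AvoiderStage b A U i →
      (∃ j, j < L ∧ AvoiderStage b A U j ∧ ∃ e ∈ U, ∀ v ∈ e, incidenceDegree A v < j + 1) ∨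
        ((∀ v, incidenceDegree A v ≤ L) ∧ U.card ≤ b) := by
  induction m with
  | zero =>
    intro i hi h
    by_cases hp : ∃ e ∈ U, ∀ v ∈ e, incidenceDegree A v < i + 1
    · exact Or.inl ⟨i, by omega, h, hp⟩
    · push Not at hp
      have h1 := h.card_le hp
      refine Or.inr ⟨fun v => (h.1 v).trans (by omega), ?_⟩
      have hL : i + 1 = L := by omega
      rw [hL] at h1
      have h2 : n ^ 2 * (2 * n) ^ L = 2 ^ L * n ^ (L + 2) := by rw [mul_pow]; ring
      have h3 : b ^ L * (2 * U.card) ≤ b ^ L * b := by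
        calc _ ≤ _ := h1
          _ ≤ b ^ (L + 1) := h2 ▸ hb
          _ = _ := pow_succ _ _
      have := Nat.le_of_mul_le_mul_left h3 (pow_pos hb0 L)
      omega
  | succ m ih =>
    intro i hi h
    by_cases hp : ∃ e ∈ U, ∀ v ∈ e, incidenceDegree A v < i + 1
    · exact Or.inl ⟨i, by omega, h, hp⟩
    · push Not at hp
      refine ih (i + 1) (by omega) ⟨fun v => (h.1 v).trans (by omega), ?_⟩
      have hN : (Finset.univ.filter fun v => incidenceDegree A v = i + 1 + 1).card = 0 := by
        rw [Finset.card_eq_zero, Finset.filter_eq_empty_iff]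
        intro v _ hv
        have := h.1 v
        omega
      rw [hN, mul_zero, zero_add]
      exact h.card_le hp

/-- At most two vertices become saturated, adding at most `2 * b` to the potential, while the loss
of at least `b` unclaimed edges removes `2 * b`. -/
theorem AvoiderStage.play {b i : ℕ} {A U U' : Finset (Sym2 (Fin n))} {e : Sym2 (Fin n)}
    (h : AvoiderStage b A U i) (he : ∀ v ∈ e, incidenceDegree A v < i + 1)
    (hU' : U'.card + b ≤ U.card) : AvoiderStage b (A ∪ {e}) U' i := by
  refine ⟨fun v => ?_, ?_⟩
  · have h1 := incidenceDegree_union_singleton_le A e v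
    have h2 := h.1 v
    split_ifs at h1 with hv
    · have := he v hv
      omega
    · omega
  · refine le_trans (Nat.mul_le_mul_left _ ?_) h.2
    have hN : (Finset.univ.filter fun v => incidenceDegree (A ∪ {e}) v = i + 1).card ≤
        (Finset.univ.filter fun v => incidenceDegree A v = i + 1).card + 2 := by
      refine le_trans (Finset.card_le_card (t := (Finset.univ.filter fun v =>
        incidenceDegree A v = i + 1) ∪ Finset.univ.filter (· ∈ e)) fun v hv => ?_) ?_
      · have h1 := incidenceDegree_union_singleton_le A e v
        have h2 := h.1 v
        simp only [Finset.mem_filter, Finset.mem_univ, true_and, Finset.mem_union] at hv ⊢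
        split_ifs at h1 with hv'
        · exact Or.inr hv'
        · exact Or.inl (by omega)
      · exact (Finset.card_union_le _ _).trans
          (Nat.add_le_add_left (card_filter_mem_sym2_le e) _)
    nlinarith [Nat.mul_le_mul_left b hN]

/-- If `b` is large, Avoider can keep all his degrees at most `L` but for one last edge. -/
theorem not_enforcerWinsMonotone_of_bounded_degree {n L b : ℕ} (hL : 1 ≤ L) (hb0 : 0 < b)
    (hb : 2 ^ L * n ^ (L + 2) ≤ b ^ (L + 1)) {𝓕 : Set (Finset (Sym2 (Fin n)))}
    (h𝓕 : ∀ F ∈ 𝓕, ∀ A₀ : Finset (Sym2 (Fin n)), ∀ e, (∀ v, incidenceDegree A₀ v ≤ L) →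
      e.card ≤ 1 → ¬ F ⊆ A₀ ∪ e) :
    ¬ EnforcerWinsMonotone (completeBoard n) 𝓕 1 b := by
  refine not_enforcerWinsFrom_of_invariant
    (fun A U => (∃ i, i < L ∧ AvoiderStage b A U i) ∨
      U = ∅ ∧ ∃ A₀ e, (∀ v, incidenceDegree A₀ v ≤ L) ∧ e.card ≤ 1 ∧ A = A₀ ∪ e) ?_ ?_ ?_
  · rintro A (⟨i, hi, h⟩ | ⟨-, A₀, e, hA₀, he, rfl⟩) F hF hFA
    · exact h𝓕 F hF A ∅ (fun v => (h.1 v).trans hi) (by simp) (by simpa using hFA)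
    · exact h𝓕 F hF A₀ e hA₀ he hFA
  · rintro A U hU (⟨i, hi, h⟩ | ⟨rfl, -⟩)
    · rcases AvoiderStage.exists_playable hb hb0 (L - i - 1) i (by omega) h with
        ⟨j, hj, hs, e, heU, he⟩ | ⟨hd, hc⟩
      · refine ⟨{e}, ⟨by simpa using heU, Or.inl (by simp)⟩, fun T hT => ?_⟩
        rcases hT.2 with hT' | rfl
        · refine Or.inl ⟨j, hj, hs.play he ?_⟩
          have h1 := Finset.card_sdiff_add_card_eq_card hT.1
          have h2 : (U \ {e}).card ≤ U.card := Finset.card_le_card Finset.sdiff_subset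
          omega
        · exact Or.inr ⟨by simp, A, {e}, fun v => (hs.1 v).trans hj, by simp, rfl⟩
      -- At most `b` edges are left. After one of them is taken, fewer than `b` remain and Enforcer
      -- must claim them all.
      · obtain ⟨e, he⟩ := hU
        refine ⟨{e}, ⟨by simpa using he, Or.inl (by simp)⟩, fun T hT => ?_⟩
        have h1 : (U \ {e}).card < U.card := Finset.card_lt_card
          ⟨Finset.sdiff_subset, fun h => by simpa using h he⟩
        have h2 := Finset.card_le_card hT.1
        rcases hT.2 with hT' | rfl
        · omega
        · exact Or.inr ⟨by simp, A, {e}, hd, by simp, rfl⟩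
    · simp at hU
  · refine Or.inl ⟨0, hL, fun v => by simp [incidenceDegree], ?_⟩
    have := two_mul_card_completeBoard_le n
    simpa [incidenceDegree] using this

end Avoider

/-! ### Enforcer's strategy: a shrinking set of untouched vertices -/

section Enforcer

variable {n : ℕ}

/-- The vertices joined to `v` by an element of `A`. -/
def neighbors (A : Finset (Sym2 (Fin n))) (v : Fin n) : Finset (Fin n) :=
  Finset.univ.filter fun w => s(v, w) ∈ A

theorem mem_neighbors {A : Finset (Sym2 (Fin n))} {v w : Fin n} :
    w ∈ neighbors A v ↔ s(v, w) ∈ A := by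
  simp [neighbors]

theorem mem_neighbors_comm {A : Finset (Sym2 (Fin n))} {v w : Fin n} :
    w ∈ neighbors A v ↔ v ∈ neighbors A w := by
  rw [mem_neighbors, mem_neighbors, Sym2.eq_swap]

theorem neighbors_mono {A A' : Finset (Sym2 (Fin n))} (h : A ⊆ A') (v : Fin n) :
    neighbors A v ⊆ neighbors A' v := fun w hw => by
  rw [mem_neighbors] at hw ⊢
  exact h hw

/-- The edges of `K_n` with an endpoint in `Z`. -/
def touching (Z : Finset (Fin n)) : Finset (Sym2 (Fin n)) :=
  (completeBoard n).filter fun e => ∃ v ∈ e, v ∈ Z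

theorem mem_touching {Z : Finset (Fin n)} {e : Sym2 (Fin n)} :
    e ∈ touching Z ↔ ¬ e.IsDiag ∧ ∃ v ∈ e, v ∈ Z := by
  simp [touching, mem_completeBoard]

theorem touching_subset (Z : Finset (Fin n)) : touching Z ⊆ completeBoard n :=
  Finset.filter_subset _ _

theorem touching_univ : touching (Finset.univ : Finset (Fin n)) = completeBoard n := by
  refine Finset.filter_true_of_mem fun e _ => ?_
  induction e with
  | _ x y => exact ⟨x, by simp⟩

theorem mk_mem_touching {Z : Finset (Fin n)} {x y : Fin n} (hx : x ∈ Z) (hxy : x ≠ y) :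
    s(x, y) ∈ touching Z :=
  mem_touching.2 ⟨by simpa using hxy, x, by simp, hx⟩

theorem card_product_le_card_sdiff_add (P Q : Finset (Fin n)) (hPQ : Disjoint P Q)
    {E A : Finset (Sym2 (Fin n))} (hE : ∀ x ∈ P, ∀ y ∈ Q, s(x, y) ∈ E) :
    P.card * Q.card ≤ (E \ A).card + A.card := by
  have h1 : ((P ×ˢ Q).image fun p => s(p.1, p.2)).card = P.card * Q.card := by
    rw [Finset.card_image_of_injOn, Finset.card_product]
    rintro ⟨x, y⟩ hxy ⟨x', y'⟩ hxy' h
    simp only [Finset.coe_product, Set.mem_prod, Finset.mem_coe] at hxy hxy'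
    rcases Sym2.eq_iff.1 h with ⟨rfl, rfl⟩ | ⟨h1, h2⟩
    · rfl
    · exact absurd (show x ∈ Q from (show x = y' from h1) ▸ hxy'.2) (Finset.disjoint_left.1 hPQ hxy.1)
  rw [← h1]
  refine (Finset.card_le_card (t := (E \ A) ∪ A) fun e he => ?_).trans (Finset.card_union_le _ _)
  obtain ⟨⟨x, y⟩, hxy, rfl⟩ := Finset.mem_image.1 he
  rw [Finset.sdiff_union_self_eq_union]
  exact Finset.mem_union_left _ (hE x (Finset.mem_product.1 hxy).1 y (Finset.mem_product.1 hxy).2)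

/-- No edge touching `Z` completes a target set. -/
def NoThreat (𝓕 : Set (Finset (Sym2 (Fin n)))) (A : Finset (Sym2 (Fin n)))
    (Z : Finset (Fin n)) : Prop :=
  ∀ e ∈ touching Z, ∀ F ∈ 𝓕, ¬ F ⊆ insert e A

/-- The properties of the targets on which Enforcer's strategy relies: sets of edges without target
are sparse, and in a position without immediate threat only few of the vertices whose edges
Enforcer has not touched can have degree at least `D` or at least `L + 1`. -/
structure IsForceable (𝓕 : Set (Finset (Sym2 (Fin n)))) (L D C K : ℕ) : Prop where
  card_le : ∀ A ⊆ completeBoard n, (∀ F ∈ 𝓕, ¬ F ⊆ A) → A.card ≤ K * n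
  eq_of_big : ∀ A ⊆ completeBoard n, ∀ Z, NoThreat 𝓕 A Z → ∀ z ∈ Z, ∀ v,
    D ≤ (neighbors A z).card → D ≤ (neighbors A v).card → z = v
  card_upgraded : ∀ A ⊆ completeBoard n, ∀ Z, NoThreat 𝓕 A Z →
    (Z.filter fun z => L + 1 ≤ (neighbors A z).card).card ≤ C

variable {𝓕 : Set (Finset (Sym2 (Fin n)))} {L D C K b t : ℕ}

theorem IsForceable.exists_winning_answer_or_noThreat (h𝓕 : IsForceable 𝓕 L D C K)
    {A : Finset (Sym2 (Fin n))} (hA : A ⊆ completeBoard n) {Z P Q : Finset (Fin n)} (hPZ : P ⊆ Z)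
    (hPQ : Disjoint P Q) (hcard : b + 1 + K * n ≤ P.card * Q.card) :
    (∃ T, IsMonotoneMove b (touching Z \ A) T ∧
      EnforcerWinsFrom 𝓕 1 b A ((touching Z \ A) \ T)) ∨ A.card ≤ K * n ∧ NoThreat 𝓕 A Z := by
  by_cases hF : ∃ F ∈ 𝓕, F ⊆ A
  · obtain ⟨F, hF, hFA⟩ := hF
    exact Or.inl ⟨_, isMonotoneMove_self _ _, enforcerWinsFrom_of_subset hF hFA⟩
  · push Not at hF
    have hAK := h𝓕.card_le A hA hF
    by_cases hN : NoThreat 𝓕 A Z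
    · exact Or.inr ⟨hAK, hN⟩
    · unfold NoThreat at hN
      push Not at hN
      obtain ⟨e, he, F, hF', hFA⟩ := hN
      refine Or.inl (exists_winning_answer hF' hFA (by simpa using Or.inr he) ?_)
      have := card_product_le_card_sdiff_add P Q hPQ (E := touching Z) (A := A) fun x hx y hy =>
        mk_mem_touching (hPZ hx) fun h => Finset.disjoint_left.1 hPQ hx (h ▸ hy)
      omega

/-- Shrinking `Z` to `Z'` is a legal move because all edges between `P` and `Q` are then released,
and only those in `A` are already gone. `P` will be the `t` abandoned vertices. -/
theorem isMonotoneMove_restrict {A : Finset (Sym2 (Fin n))} {Z Z' P Q : Finset (Fin n)}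
    (hPZ : P ⊆ Z) (hPQ : Disjoint P Q) (hP : Disjoint P Z') (hQ : Disjoint Q Z')
    (hcard : b + A.card ≤ P.card * Q.card) :
    IsMonotoneMove b (touching Z \ A) ((touching Z \ A) \ touching Z') := by
  refine ⟨Finset.sdiff_subset, Or.inl ?_⟩
  have h1 : (touching Z \ A) \ touching Z' = (touching Z \ touching Z') \ A := by
    rw [sdiff_right_comm]
  have := card_product_le_card_sdiff_add P Q hPQ (E := touching Z \ touching Z') (A := A)
    fun x hx y hy => by
      refine Finset.mem_sdiff.2 ⟨mk_mem_touching (hPZ hx)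
        fun h => Finset.disjoint_left.1 hPQ hx (h ▸ hy), fun h => ?_⟩
      obtain ⟨-, v, hv, hvZ⟩ := mem_touching.1 h
      rcases Sym2.mem_iff.1 hv with rfl | rfl
      · exact Finset.disjoint_left.1 hP hx hvZ
      · exact Finset.disjoint_left.1 hQ hy hvZ
  rw [h1]
  omega

theorem sdiff_restrict {A : Finset (Sym2 (Fin n))} {Z Z' : Finset (Fin n)} (hZ : Z' ⊆ Z) :
    (touching Z \ A) \ ((touching Z \ A) \ touching Z') = touching Z' \ A := by
  have h : touching Z' ⊆ touching Z := fun e he => by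
    obtain ⟨h1, v, hv, hvZ⟩ := mem_touching.1 he
    exact mem_touching.2 ⟨h1, v, hv, hZ hvZ⟩
  ext e
  have := @h e
  simp only [Finset.mem_sdiff]
  tauto

/-- The weight, at the stage `i`, of a vertex of degree `d`. -/
def stageWeight (t D i d : ℕ) : ℕ := if d ≤ i then 1 else (t + 1) * (min d D - i)

theorem one_le_stageWeight {i d : ℕ} (hi : i < D) : 1 ≤ stageWeight t D i d := by
  unfold stageWeight
  split_ifs
  · rfl
  · exact Nat.mul_pos (Nat.succ_pos t) (by omega)

theorem stageWeight_le {i d : ℕ} (hi : i < D) : stageWeight t D i d ≤ (t + 1) * D := by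
  unfold stageWeight
  split_ifs
  · exact Nat.mul_pos (Nat.succ_pos t) (by omega)
  · exact Nat.mul_le_mul_left _ (by omega)

theorem stageWeight_add_le {i d d' : ℕ} (hi : i < D) (hid : i ≤ d) (hd : d < D) (hdd' : d < d') :
    stageWeight t D i d + t ≤ stageWeight t D i d' := by
  unfold stageWeight
  split_ifs with h1 h2 h2
  · omega
  · have := Nat.le_mul_of_pos_right (t + 1) (show 0 < min d' D - i by omega)
    omega
  · omega
  · have := Nat.mul_le_mul_left (t + 1) (show min d D - i + 1 ≤ min d' D - i by omega)
    rw [mul_add] at this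
    omega

theorem stageWeight_mono {i d d' : ℕ} (hi : i < D) (hdd' : d ≤ d') :
    stageWeight t D i d ≤ stageWeight t D i d' := by
  by_cases h : d ≤ i
  · exact (if_pos h).trans_le (one_le_stageWeight hi)
  · unfold stageWeight
    rw [if_neg h, if_neg (by omega)]
    exact Nat.mul_le_mul_left _ (by omega)

theorem sum_stageWeight_le {i : ℕ} (hi : i < D) (Z : Finset (Fin n)) (d : Fin n → ℕ) :
    ∑ z ∈ Z, stageWeight t D i (d z) ≤
      (Z.filter fun z => d z ≤ i).card + (t + 1) * D * (Z.filter fun z => i + 1 ≤ d z).card := by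
  rw [← Finset.sum_filter_add_sum_filter_not Z fun z => d z ≤ i]
  refine Nat.add_le_add ?_ ?_
  · rw [Finset.card_eq_sum_ones]
    refine Finset.sum_le_sum fun z hz => ?_
    simp [stageWeight, (Finset.mem_filter.1 hz).2]
  · simp only [not_le, Nat.succ_le_iff]
    rw [mul_comm, ← smul_eq_mul]
    exact Finset.sum_le_card_nsmul _ _ _ fun z _ => stageWeight_le hi

/-- The potential Enforcer needs when `j` stages remain after the current one. -/
def quota (t D C : ℕ) : ℕ → ℕ
  | 0 => (t + 1) * D * (C + 2)
  | j + 1 => (t + 1) * D * (quota t D C j + t + 3)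

theorem le_quota (hD : 0 < D) (j : ℕ) : t + 1 ≤ quota t D C j := by
  cases j with
  | zero =>
    rw [quota, mul_assoc]
    exact Nat.le_mul_of_pos_right _ (by positivity)
  | succ j =>
    rw [quota, mul_assoc]
    exact Nat.le_mul_of_pos_right _ (by positivity)

/-- One if `A` has a vertex of degree at least `D`, and zero otherwise. -/
noncomputable def bigIndicator (D : ℕ) (A : Finset (Sym2 (Fin n))) : ℕ :=
  open Classical in if ∃ v, D ≤ (neighbors A v).card then 1 else 0

/-- Avoider is to move, Enforcer has not touched the edges at `Z`, all degrees in `Z` are at least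
`i` and less than `D`, and the potential suffices for `j` further stages. -/
structure EnforcerStage (t D C : ℕ) (A : Finset (Sym2 (Fin n))) (Z : Finset (Fin n))
    (i j : ℕ) : Prop where
  card_le : Z.card ≤ n - n / 2
  le_card : t ≤ Z.card
  le_degree : ∀ z ∈ Z, i ≤ (neighbors A z).card
  degree_lt : ∀ z ∈ Z, (neighbors A z).card < D
  quota_le : quota t D C j ≤ ∑ z ∈ Z, stageWeight t D i (neighbors A z).card +
    (t + 1) * D * bigIndicator D A

/-- Any edge Avoider takes has an endpoint in `Z`, whose degree lies between `i` and `D - 1`; its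
growth is worth at least `t`. This gain pays for abandoning `t` vertices of weight one. -/
theorem EnforcerStage.potential_add_le {i j : ℕ} (hi : i < D) {A S : Finset (Sym2 (Fin n))}
    {Z : Finset (Fin n)} (h : EnforcerStage t D C A Z i j) (hS : S.Nonempty)
    (hSU : S ⊆ touching Z \ A) :
    ∑ z ∈ Z, stageWeight t D i (neighbors A z).card + t ≤
      ∑ z ∈ Z, stageWeight t D i (neighbors (A ∪ S) z).card := by
  obtain ⟨e, he⟩ := hS
  obtain ⟨he1, heA⟩ := Finset.mem_sdiff.1 (hSU he)
  obtain ⟨-, v, ⟨w, rfl⟩, hvZ⟩ := mem_touching.1 he1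
  rw [← Finset.add_sum_erase Z _ hvZ, ← Finset.add_sum_erase Z _ hvZ]
  have h1 : stageWeight t D i (neighbors A v).card + t ≤
      stageWeight t D i (neighbors (A ∪ S) v).card := by
    refine stageWeight_add_le hi (h.le_degree v hvZ) (h.degree_lt v hvZ)
      (Finset.card_lt_card ⟨neighbors_mono Finset.subset_union_left v, fun h => heA ?_⟩)
    exact mem_neighbors.1 (h (mem_neighbors.2 (Finset.mem_union_right _ he)))
  have h2 : ∑ z ∈ Z.erase v, stageWeight t D i (neighbors A z).card ≤
      ∑ z ∈ Z.erase v, stageWeight t D i (neighbors (A ∪ S) z).card :=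
    Finset.sum_le_sum fun z _ => stageWeight_mono hi
      (Finset.card_le_card (neighbors_mono Finset.subset_union_left z))
  omega

/-- Giving up the big vertices of `Z` does not decrease the potential, because of the indicator. -/
theorem sum_big_add_bigIndicator_le {i : ℕ} (hi : i < D) {A A' : Finset (Sym2 (Fin n))}
    (hAA' : A ⊆ A') {Z : Finset (Fin n)} (hZ : ∀ z ∈ Z, (neighbors A z).card < D)
    (hbig : ∀ z ∈ Z, ∀ v, D ≤ (neighbors A' z).card → D ≤ (neighbors A' v).card → z = v) :
    ∑ z ∈ Z with D ≤ (neighbors A' z).card, stageWeight t D i (neighbors A' z).card +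
      (t + 1) * D * bigIndicator D A ≤ (t + 1) * D * bigIndicator D A' := by
  have hmono : ∀ v, (neighbors A v).card ≤ (neighbors A' v).card := fun v =>
    Finset.card_le_card (neighbors_mono hAA' v)
  rcases (Z.filter fun z => D ≤ (neighbors A' z).card).eq_empty_or_nonempty with h | ⟨z, hz⟩
  · rw [h, Finset.sum_empty, zero_add]
    refine Nat.mul_le_mul_left _ ?_
    unfold bigIndicator
    split_ifs with h1 h2
    · rfl
    · exact absurd (h1.imp fun v hv => hv.trans (hmono v)) h2
    · simp
    · rfl
  · obtain ⟨hzZ, hzD⟩ := Finset.mem_filter.1 hz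
    have h1 : bigIndicator D A = 0 := by
      refine if_neg ?_
      rintro ⟨v, hv⟩
      have := hbig z hzZ v hzD (hv.trans (hmono v))
      subst this
      exact absurd (hZ z hzZ) (not_lt.2 hv)
    have h2 : bigIndicator D A' = 1 := if_pos ⟨z, hzD⟩
    have h3 : (Z.filter fun z => D ≤ (neighbors A' z).card) = {z} := by
      refine Finset.eq_singleton_iff_unique_mem.2 ⟨hz, fun v hv => ?_⟩
      exact (hbig z hzZ v hzD (Finset.mem_filter.1 hv).2).symm
    rw [h1, h2, h3, Finset.sum_singleton, mul_zero, mul_one, add_zero]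
    exact stageWeight_le hi

theorem card_big_le_one {A : Finset (Sym2 (Fin n))} {Z : Finset (Fin n)}
    (hbig : ∀ z ∈ Z, ∀ v, D ≤ (neighbors A z).card → D ≤ (neighbors A v).card → z = v) :
    (Z.filter fun z => D ≤ (neighbors A z).card).card ≤ 1 :=
  Finset.card_le_one.2 fun x hx y hy => by
    rw [Finset.mem_filter] at hx hy
    exact hbig x hx.1 y hx.2 hy.2

/-- Enforcer's choice of the vertices to give up. -/
theorem EnforcerStage.exists_restriction {i j : ℕ} (hij : i + j = L) (hLD : L < D)
    {A S : Finset (Sym2 (Fin n))} {Z : Finset (Fin n)} (h : EnforcerStage t D C A Z i j)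
    (hS : S.Nonempty) (hSU : S ⊆ touching Z \ A)
    (hbig : ∀ z ∈ Z, ∀ v, D ≤ (neighbors (A ∪ S) z).card → D ≤ (neighbors (A ∪ S) v).card → z = v)
    (hup : (Z.filter fun z => L + 1 ≤ (neighbors (A ∪ S) z).card).card ≤ C) :
    ∃ R ⊆ Z, R.card = t ∧ ∃ Z' ⊆ Z, Disjoint R Z' ∧
      ∃ i' j', i' + j' = L ∧ EnforcerStage t D C (A ∪ S) Z' i' j' := by
  have hi : i < D := by omega
  have hD : 0 < D := by omega
  set d : Fin n → ℕ := fun z => (neighbors (A ∪ S) z).card with hd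
  have hid : ∀ z ∈ Z, i ≤ d z := fun z hz => (h.le_degree z hz).trans
    (Finset.card_le_card (neighbors_mono Finset.subset_union_left z))
  have hpot := h.potential_add_le hi hS hSU
  have hind := sum_big_add_bigIndicator_le (t := t) hi (Finset.subset_union_left (s₂ := S))
    h.degree_lt hbig
  have hone := card_big_le_one hbig
  have hquota := h.quota_le
  change _ ≤ ∑ z ∈ Z, stageWeight t D i (d z) at hpot
  change ∑ z ∈ Z.filter (fun z => D ≤ d z), stageWeight t D i (d z) + _ ≤ _ at hind
  change (Z.filter fun z => D ≤ d z).card ≤ 1 at hone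
  change (Z.filter fun z => L + 1 ≤ d z).card ≤ C at hup
  set B := Z.filter fun z => D ≤ d z with hB
  set low := Z.filter fun z => d z ≤ i with hlow
  set up := Z.filter fun z => i + 1 ≤ d z with hup'
  have hBZ : B ⊆ Z := Finset.filter_subset _ _
  have hlowup : low.card + up.card = Z.card := by
    rw [← Finset.card_filter_add_card_filter_not (s := Z) fun z => d z ≤ i]
    simp only [hlow, hup', not_le, Nat.succ_le_iff]
  have hsum : ∑ z ∈ Z, stageWeight t D i (d z) ≤ low.card + (t + 1) * D * up.card :=
    sum_stageWeight_le (t := t) hi Z d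
  have hindle : bigIndicator D (A ∪ S) ≤ 1 := by unfold bigIndicator; split_ifs <;> simp
  have hindle' := Nat.mul_le_mul_left ((t + 1) * D) hindle
  by_cases hcase : t ≤ low.card
  -- Enough vertices of degree `i`: `t` of them are abandoned, at weight one each, together with the
  -- big vertex if there is one. The potential is kept and the stage continues.
  · obtain ⟨R, hRlow, hRt⟩ := Finset.exists_subset_card_eq hcase
    have hRZ : R ⊆ Z := hRlow.trans (Finset.filter_subset _ _)
    have hRB : Disjoint R B := Finset.disjoint_left.2 fun z hz hzB => by
      have h1 := (Finset.mem_filter.1 (hRlow hz)).2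
      have h2 := (Finset.mem_filter.1 hzB).2
      omega
    set Z' := Z \ (R ∪ B) with hZ'
    have hZ'Z : Z' ⊆ Z := Finset.sdiff_subset
    have hpot' : quota t D C j ≤ ∑ z ∈ Z', stageWeight t D i (d z) +
        (t + 1) * D * bigIndicator D (A ∪ S) := by
      have h1 := Finset.sum_sdiff (f := fun z => stageWeight t D i (d z))
        (Finset.union_subset hRZ hBZ)
      rw [Finset.sum_union hRB, ← hZ'] at h1
      have h2 : ∑ z ∈ R, stageWeight t D i (d z) = t := by
        rw [← hRt, Finset.card_eq_sum_ones]
        exact Finset.sum_congr rfl fun z hz => if_pos (Finset.mem_filter.1 (hRlow hz)).2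
      omega
    have hcard : t ≤ Z'.card := by
      have hsum' := sum_stageWeight_le (t := t) hi Z' d
      cases j with
      | zero =>
        have hiL : i = L := by omega
        have h1 : (Z'.filter fun z => i + 1 ≤ d z).card ≤ C :=
          (Finset.card_le_card (Finset.filter_subset_filter _ hZ'Z)).trans (hiL ▸ hup)
        have h2 := Nat.mul_le_mul_left ((t + 1) * D) h1
        have h3 := Finset.card_filter_le Z' fun z => d z ≤ i
        have h4 : t + 1 ≤ (t + 1) * D := Nat.le_mul_of_pos_right _ hD
        rw [quota, mul_add] at hpot'
        omega
      | succ j =>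
        have h1 : ∑ z ∈ Z', stageWeight t D i (d z) ≤ Z'.card * ((t + 1) * D) := by
          rw [← smul_eq_mul]
          exact Finset.sum_le_card_nsmul _ _ _ fun z _ => stageWeight_le hi
        rw [quota] at hpot'
        by_contra hlt
        have h2 : Z'.card + 1 + 1 ≤ quota t D C j + t + 3 := by omega
        have h3 := Nat.mul_le_mul_left ((t + 1) * D) h2
        have h4 : 0 < (t + 1) * D := by positivity
        rw [mul_add, mul_add, mul_comm _ Z'.card] at h3
        omega
    refine ⟨R, hRZ, hRt, Z', hZ'Z, ?_, i, j, hij, ⟨?_, hcard, ?_, ?_, hpot'⟩⟩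
    · exact Finset.disjoint_left.2 fun z hz hz' =>
        (Finset.mem_sdiff.1 hz').2 (Finset.mem_union_left _ hz)
    · exact (Finset.card_le_card hZ'Z).trans h.card_le
    · exact fun z hz => hid z (hZ'Z hz)
    · intro z hz
      by_contra hlt
      exact (Finset.mem_sdiff.1 hz).2
        (Finset.mem_union_right _ (Finset.mem_filter.2 ⟨hZ'Z hz, not_lt.1 hlt⟩))
  -- Fewer than `t` vertices of degree `i` remain, so the potential comes from vertices of higher
  -- degree. In the last stage there are at most `C` of these, a contradiction; otherwise all low
  -- vertices are abandoned and the next stage starts.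
  · cases j with
    | zero =>
      exfalso
      have hiL : i = L := by omega
      have h1 : up.card ≤ C := by rw [hup', hiL]; exact hup
      have h2 := Nat.mul_le_mul_left ((t + 1) * D) h1
      have h4 : t + 1 ≤ (t + 1) * D := Nat.le_mul_of_pos_right _ hD
      rw [quota, mul_add] at hquota
      omega
    | succ j =>
      obtain ⟨R, hlowR, hRZ, hRt⟩ := Finset.exists_subsuperset_card_eq
        (Finset.filter_subset (fun z => d z ≤ i) Z) (not_le.1 hcase).le h.le_card
      set Z' := Z \ (R ∪ B) with hZ'
      have hZ'Z : Z' ⊆ Z := Finset.sdiff_subset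
      have hcard : quota t D C j ≤ Z'.card := by
        have h1 := Finset.card_sdiff_add_card_eq_card (Finset.union_subset hRZ hBZ)
        rw [← hZ'] at h1
        have h2 := Finset.card_union_le R B
        have h4 : t + 1 ≤ (t + 1) * D := Nat.le_mul_of_pos_right _ hD
        rw [quota] at hquota
        by_contra hlt
        -- The summand `t + 3` covers the `t` vertices of `R`, the big vertex, the indicator, and
        -- the weight of the low vertices.
        have h5 : up.card + 1 + 1 ≤ quota t D C j + t + 3 := by omega
        have h6 := Nat.mul_le_mul_left ((t + 1) * D) h5
        rw [mul_add, mul_add] at h6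
        omega
      have hid' : ∀ z ∈ Z', i + 1 ≤ d z := by
        intro z hz
        by_contra hlt
        exact (Finset.mem_sdiff.1 hz).2 (Finset.mem_union_left _
          (hlowR (Finset.mem_filter.2 ⟨hZ'Z hz, by omega⟩)))
      refine ⟨R, hRZ, hRt, Z', hZ'Z, ?_, i + 1, j, by omega, ⟨?_, ?_, hid', ?_, ?_⟩⟩
      · exact Finset.disjoint_left.2 fun z hz hz' =>
          (Finset.mem_sdiff.1 hz').2 (Finset.mem_union_left _ hz)
      · exact (Finset.card_le_card hZ'Z).trans h.card_le
      · have := le_quota (t := t) (C := C) hD j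
        omega
      · intro z hz
        by_contra hlt
        exact (Finset.mem_sdiff.1 hz).2
          (Finset.mem_union_right _ (Finset.mem_filter.2 ⟨hZ'Z hz, not_lt.1 hlt⟩))
      · refine hcard.trans (le_add_right ?_)
        rw [Finset.card_eq_sum_ones]
        exact Finset.sum_le_sum fun z _ => one_le_stageWeight (by omega)

/-- The invariant says that the unclaimed edges are those at `Z` outside `A`. It can always be
restored unless a target is complete or threatened, when Enforcer wins at once. -/
theorem enforcerWinsMonotone_of_isForceable (h𝓕 : IsForceable 𝓕 L D C K) (hLD : L < D)
    (ht : 1 ≤ t) (hb : b + 1 + K * n ≤ t * (n / 2)) (hn : 4 * quota t D C L ≤ n) :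
    EnforcerWinsMonotone (completeBoard n) 𝓕 1 b := by
  have hD : 0 < D := by omega
  have htq := le_quota (t := t) (C := C) hD L
  refine enforcerWinsFrom_of_invariant
    (fun A U => A ⊆ completeBoard n ∧ ((∃ Z i j, i + j = L ∧ U = touching Z \ A ∧
      EnforcerStage t D C A Z i j) ∨ U = completeBoard n ∧ A = ∅)) ?_ ?_
    ⟨Finset.empty_subset _, Or.inr ⟨rfl, rfl⟩⟩
  · rintro A ⟨hA, ⟨Z, i, j, -, hU, hs⟩ | ⟨hU, -⟩⟩
    · by_contra hF
      push Not at hF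
      -- If play ends with the invariant intact, Avoider owns every edge at `Z`, which is too many
      -- for a set without target.
      have h1 := h𝓕.card_le A hA hF
      have h2 := card_product_le_card_sdiff_add Z Zᶜ disjoint_compl_right (E := touching Z) (A := A)
        fun x hx y hy => mk_mem_touching hx fun h => (Finset.mem_compl.1 hy) (h ▸ hx)
      rw [← hU, Finset.card_empty, zero_add] at h2
      have h3 : t * (n / 2) ≤ Z.card * Zᶜ.card := by
        refine Nat.mul_le_mul hs.le_card ?_
        rw [Finset.card_compl, Fintype.card_fin]
        have := hs.card_le
        omega
      omega
    · exfalso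
      have : s((⟨0, by omega⟩ : Fin n), ⟨1, by omega⟩) ∈ completeBoard n :=
        mk_mem_completeBoard.2 (by simp)
      rw [← hU] at this
      simp at this
  · rintro A U hU ⟨hA, ⟨Z, i, j, hij, rfl, hs⟩ | ⟨rfl, rfl⟩⟩ S hS
    · have hSne := hS.nonempty hU
      have hA' : A ∪ S ⊆ completeBoard n := Finset.union_subset hA
        (hS.1.trans (Finset.sdiff_subset.trans (touching_subset Z)))
      have hUS : (touching Z \ A) \ S = touching Z \ (A ∪ S) := by
        rw [sdiff_sdiff_left, Finset.sup_eq_union]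
      rw [hUS]
      have hc : n / 2 ≤ Zᶜ.card := by
        rw [Finset.card_compl, Fintype.card_fin]
        have := hs.card_le
        omega
      rcases h𝓕.exists_winning_answer_or_noThreat (b := b) hA' (subset_refl Z)
        disjoint_compl_right (hb.trans (Nat.mul_le_mul hs.le_card hc)) with ⟨T, hT, hw⟩ | ⟨hK, hN⟩
      · exact ⟨T, hT, Or.inl hw⟩
      · obtain ⟨R, hRZ, hRt, Z', hZ', hRZ', i', j', hij', hs'⟩ := hs.exists_restriction hij hLD
          hSne hS.1 (h𝓕.eq_of_big _ hA' _ hN) (h𝓕.card_upgraded _ hA' _ hN)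
        refine ⟨_, isMonotoneMove_restrict (P := R) (Q := Zᶜ) hRZ ?_ hRZ' ?_ ?_, Or.inr
          ⟨hA', Or.inl ⟨Z', i', j', hij', sdiff_restrict hZ', hs'⟩⟩⟩
        · exact (disjoint_compl_right (a := Z)).mono_left hRZ
        · exact (disjoint_compl_left (a := Z)).mono_right hZ'
        · have := Nat.mul_le_mul hRt.ge hc
          omega
    · have hUS : completeBoard n \ S = touching Finset.univ \ (∅ ∪ S) := by
        rw [touching_univ, Finset.empty_union]
      have hA' : ∅ ∪ S ⊆ completeBoard n := by simpa using hS.1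
      rw [hUS]
      -- Answer to the opening move: `Z` is any set of `quota t D C L` vertices avoiding `P` and the
      -- big vertex. All weights are at least one, so its size alone supplies the potential.
      obtain ⟨P, -, hP⟩ := Finset.exists_subset_card_eq
        (s := (Finset.univ : Finset (Fin n))) (n := t) (by simp; omega)
      have hPc : Pᶜ.card = n - t := by rw [Finset.card_compl, Fintype.card_fin, hP]
      rcases h𝓕.exists_winning_answer_or_noThreat (b := b) hA' (Finset.subset_univ P)
        disjoint_compl_right (hb.trans (Nat.mul_le_mul hP.ge
          (show n / 2 ≤ Pᶜ.card by omega))) with ⟨T, hT, hw⟩ | ⟨hK, hN⟩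
      · exact ⟨T, hT, Or.inl hw⟩
      · have hbig := h𝓕.eq_of_big _ hA' _ hN
        have hone := card_big_le_one hbig
        set B := Finset.univ.filter fun z => D ≤ (neighbors (∅ ∪ S) z).card
        obtain ⟨Z, hZ, hZc⟩ := Finset.exists_subset_card_eq (s := Pᶜ \ B) (n := quota t D C L) (by
          have := Finset.le_card_sdiff B Pᶜ
          omega)
        have hPZ : Disjoint P Z := Finset.disjoint_left.2 fun x hx hx' =>
          (Finset.mem_compl.1 (Finset.mem_sdiff.1 (hZ hx')).1) hx
        refine ⟨_, isMonotoneMove_restrict (P := P) (Q := (P ∪ Z)ᶜ) (Z' := Z)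
          (Finset.subset_univ P) ?_ hPZ ?_ ?_, Or.inr ⟨hA', Or.inl ⟨Z, 0, L, by simp,
            sdiff_restrict (Finset.subset_univ _), ⟨?_, ?_, ?_, ?_, ?_⟩⟩⟩⟩
        · exact disjoint_compl_right.mono_left Finset.subset_union_left
        · exact disjoint_compl_left.mono_right Finset.subset_union_right
        · have hc : n / 2 ≤ (P ∪ Z)ᶜ.card := by
            rw [Finset.card_compl, Fintype.card_fin]
            have := Finset.card_union_le P Z
            omega
          have := Nat.mul_le_mul hP.ge hc
          omega
        · omega
        · omega
        · simp
        · intro z hz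
          by_contra hlt
          exact (Finset.mem_sdiff.1 (hZ hz)).2
            (Finset.mem_filter.2 ⟨Finset.mem_univ z, not_lt.1 hlt⟩)
        · refine le_add_right ?_
          rw [← hZc, Finset.card_eq_sum_ones]
          exact Finset.sum_le_sum fun z _ => one_le_stageWeight (by omega)

end Enforcer

/-! ### Double stars and path double stars as targets -/

section Copies

variable {n k : ℕ}

theorem exists_mem_copies_of_embedding {W : Type*} [Finite W] {H : SimpleGraph W}
    (φ : W ↪ Fin n) :
    ∃ F ∈ copiesInComplete H n, ∀ A : Finset (Sym2 (Fin n)),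
      (∀ e ∈ H.edgeSet, Sym2.map φ e ∈ A) → F ⊆ A := by
  refine ⟨(Set.toFinite (Sym2.map φ '' H.edgeSet)).toFinset, ⟨φ, by simp⟩, fun A hA f hf => ?_⟩
  rw [Set.Finite.mem_toFinset] at hf
  obtain ⟨e, he, rfl⟩ := hf
  exact hA e he

instance : Finite (DoubleStarVertex k) :=
  Finite.of_surjective (fun x : Bool ⊕ Fin (k - 1) ⊕ Fin (k - 1) => match x with
    | .inl true => DoubleStarVertex.u
    | .inl false => .v
    | .inr (.inl i) => .uLeaf i
    | .inr (.inr i) => .vLeaf i) fun x => by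
    cases x with
    | u => exact ⟨.inl true, rfl⟩
    | v => exact ⟨.inl false, rfl⟩
    | uLeaf i => exact ⟨.inr (.inl i), rfl⟩
    | vLeaf i => exact ⟨.inr (.inr i), rfl⟩

instance : Finite (PathDoubleStarVertex k) :=
  Finite.of_surjective (fun x : Option Bool ⊕ Fin (k - 1) ⊕ Fin (k - 1) => match x with
    | .inl none => PathDoubleStarVertex.w
    | .inl (some true) => .u
    | .inl (some false) => .v
    | .inr (.inl i) => .uLeaf i
    | .inr (.inr i) => .vLeaf i) fun x => by
    cases x with
    | w => exact ⟨.inl none, rfl⟩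
    | u => exact ⟨.inl (some true), rfl⟩
    | v => exact ⟨.inl (some false), rfl⟩
    | uLeaf i => exact ⟨.inr (.inl i), rfl⟩
    | vLeaf i => exact ⟨.inr (.inr i), rfl⟩

theorem notMem_neighbors_self {A : Finset (Sym2 (Fin n))} (hA : A ⊆ completeBoard n) (v : Fin n) :
    v ∉ neighbors A v := fun h =>
  mk_mem_completeBoard.1 (hA (mem_neighbors.1 h)) rfl

theorem exists_doubleStar_subset {A : Finset (Sym2 (Fin n))} (hA : A ⊆ completeBoard n)
    {x y : Fin n} (hxy : s(x, y) ∈ A) {P : Finset (Fin n)} (hP : P ⊆ neighbors A x)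
    (hPk : P.card = k - 1) (hyP : y ∉ P)
    (hQ : k - 1 ≤ (neighbors A y \ insert x P).card) :
    ∃ F ∈ copiesInComplete (doubleStar k) n, F ⊆ A := by
  obtain ⟨Q, hQ, hQk⟩ := Finset.exists_subset_card_eq hQ
  let p := (Finset.equivFinOfCardEq hPk).symm
  let q := (Finset.equivFinOfCardEq hQk).symm
  have hxy' : x ≠ y := mk_mem_completeBoard.1 (hA hxy)
  have hxP : x ∉ P := fun h => notMem_neighbors_self hA x (hP h)
  have hyQ : y ∉ Q := fun h => notMem_neighbors_self hA y (Finset.mem_sdiff.1 (hQ h)).1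
  have hxQ : x ∉ Q := fun h => (Finset.mem_sdiff.1 (hQ h)).2 (Finset.mem_insert_self _ _)
  have hPQ : ∀ i j, (p i : Fin n) ≠ q j := fun i j h =>
    (Finset.mem_sdiff.1 (hQ (q j).2)).2 (Finset.mem_insert_of_mem (h ▸ (p i).2))
  have hxp : ∀ i, x ≠ p i := fun i h => hxP (h ▸ (p i).2)
  have hyp : ∀ i, y ≠ p i := fun i h => hyP (h ▸ (p i).2)
  have hxq : ∀ i, x ≠ q i := fun i h => hxQ (h ▸ (q i).2)
  have hyq : ∀ i, y ≠ q i := fun i h => hyQ (h ▸ (q i).2)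
  let f : DoubleStarVertex k → Fin n := fun z => match z with
    | .u => x
    | .v => y
    | .uLeaf i => p i
    | .vLeaf i => q i
  have hf : Function.Injective f := by
    intro a b hab
    cases a <;> cases b <;> simp only [f] at hab <;>
      first
        | rfl
        | exact absurd hab hxy'
        | exact absurd hab.symm hxy'
        | exact absurd hab (hxp _)
        | exact absurd hab.symm (hxp _)
        | exact absurd hab (hyp _)
        | exact absurd hab.symm (hyp _)
        | exact absurd hab (hxq _)
        | exact absurd hab.symm (hxq _)
        | exact absurd hab (hyq _)
        | exact absurd hab.symm (hyq _)
        | exact absurd hab (hPQ _ _)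
        | exact absurd hab.symm (hPQ _ _)
        | exact congrArg _ (p.injective (Subtype.ext hab))
        | exact congrArg _ (q.injective (Subtype.ext hab))
  obtain ⟨F, hF, hFA⟩ := exists_mem_copies_of_embedding (H := doubleStar k) ⟨f, hf⟩
  refine ⟨F, hF, hFA A fun e he => ?_⟩
  rw [doubleStar, SimpleGraph.edgeSet_fromEdgeSet] at he
  rcases he.1 with (rfl | ⟨i, rfl⟩) | ⟨i, rfl⟩
  · exact hxy
  · exact mem_neighbors.1 (hP (p i).2)
  · exact mem_neighbors.1 (Finset.mem_sdiff.1 (hQ (q i).2)).1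

theorem exists_pathDoubleStar_subset {A : Finset (Sym2 (Fin n))} (hA : A ⊆ completeBoard n)
    {x w y : Fin n} (hxy : x ≠ y) (hxw : s(x, w) ∈ A) (hyw : s(y, w) ∈ A)
    {P : Finset (Fin n)} (hP : P ⊆ neighbors A x) (hPk : P.card = k - 1) (hyP : y ∉ P)
    (hwP : w ∉ P) (hQ : k - 1 ≤ (neighbors A y \ insert x (insert w P)).card) :
    ∃ F ∈ copiesInComplete (pathDoubleStar k) n, F ⊆ A := by
  obtain ⟨Q, hQ, hQk⟩ := Finset.exists_subset_card_eq hQ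
  let p := (Finset.equivFinOfCardEq hPk).symm
  let q := (Finset.equivFinOfCardEq hQk).symm
  have hxw' : x ≠ w := mk_mem_completeBoard.1 (hA hxw)
  have hyw' : y ≠ w := mk_mem_completeBoard.1 (hA hyw)
  have hxP : x ∉ P := fun h => notMem_neighbors_self hA x (hP h)
  have hyQ : y ∉ Q := fun h => notMem_neighbors_self hA y (Finset.mem_sdiff.1 (hQ h)).1
  have hxQ : x ∉ Q := fun h => (Finset.mem_sdiff.1 (hQ h)).2 (Finset.mem_insert_self _ _)
  have hwQ : w ∉ Q := fun h => (Finset.mem_sdiff.1 (hQ h)).2 (by simp)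
  have hPQ : ∀ i j, (p i : Fin n) ≠ q j := fun i j h =>
    (Finset.mem_sdiff.1 (hQ (q j).2)).2
      (Finset.mem_insert_of_mem (Finset.mem_insert_of_mem (h ▸ (p i).2)))
  have hxp : ∀ i, x ≠ p i := fun i h => hxP (h ▸ (p i).2)
  have hyp : ∀ i, y ≠ p i := fun i h => hyP (h ▸ (p i).2)
  have hwp : ∀ i, w ≠ p i := fun i h => hwP (h ▸ (p i).2)
  have hxq : ∀ i, x ≠ q i := fun i h => hxQ (h ▸ (q i).2)
  have hyq : ∀ i, y ≠ q i := fun i h => hyQ (h ▸ (q i).2)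
  have hwq : ∀ i, w ≠ q i := fun i h => hwQ (h ▸ (q i).2)
  let f : PathDoubleStarVertex k → Fin n := fun z => match z with
    | .w => w
    | .u => x
    | .v => y
    | .uLeaf i => p i
    | .vLeaf i => q i
  have hf : Function.Injective f := by
    intro a b hab
    cases a <;> cases b <;> simp only [f] at hab <;>
      first
        | rfl
        | exact absurd hab hxy
        | exact absurd hab.symm hxy
        | exact absurd hab hxw'
        | exact absurd hab.symm hxw'
        | exact absurd hab hyw'
        | exact absurd hab.symm hyw'
        | exact absurd hab (hxp _)
        | exact absurd hab.symm (hxp _)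
        | exact absurd hab (hyp _)
        | exact absurd hab.symm (hyp _)
        | exact absurd hab (hwp _)
        | exact absurd hab.symm (hwp _)
        | exact absurd hab (hxq _)
        | exact absurd hab.symm (hxq _)
        | exact absurd hab (hyq _)
        | exact absurd hab.symm (hyq _)
        | exact absurd hab (hwq _)
        | exact absurd hab.symm (hwq _)
        | exact absurd hab (hPQ _ _)
        | exact absurd hab.symm (hPQ _ _)
        | exact congrArg _ (p.injective (Subtype.ext hab))
        | exact congrArg _ (q.injective (Subtype.ext hab))
  obtain ⟨F, hF, hFA⟩ := exists_mem_copies_of_embedding (H := pathDoubleStar k) ⟨f, hf⟩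
  refine ⟨F, hF, hFA A fun e he => ?_⟩
  rw [pathDoubleStar, SimpleGraph.edgeSet_fromEdgeSet] at he
  rcases he.1 with ((rfl | rfl) | ⟨i, rfl⟩) | ⟨i, rfl⟩
  · exact hxw
  · exact hyw
  · exact mem_neighbors.1 (hP (p i).2)
  · exact mem_neighbors.1 (Finset.mem_sdiff.1 (hQ (q i).2)).1

/-- A set of edges in which every vertex of degree at least `D` has at most one neighbour of degree
at least `D` has at most `D * n` elements. -/
theorem card_le_of_big_neighbors {A : Finset (Sym2 (Fin n))} {D : ℕ} (hD : 1 ≤ D)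
    (h : ∀ v w w', D ≤ (neighbors A v).card → w ∈ neighbors A v → w' ∈ neighbors A v →
      D ≤ (neighbors A w).card → D ≤ (neighbors A w').card → w = w') : A.card ≤ D * n := by
  -- Each edge is charged to an endpoint: to a small one if it exists, otherwise to either. A small
  -- vertex then receives fewer than `D` edges, a big one at most one.
  let N : Fin n → Finset (Fin n) := fun v =>
    if (neighbors A v).card < D then neighbors A v
    else (neighbors A v).filter fun w => D ≤ (neighbors A w).card
  have hN : ∀ v, (N v).card ≤ D := fun v => by
    by_cases hv : (neighbors A v).card < D
    · simp only [N, if_pos hv]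
      exact hv.le
    · simp only [N, if_neg hv]
      refine le_trans (Finset.card_le_one.2 fun x hx y hy => ?_) hD
      rw [Finset.mem_filter] at hx hy
      exact h v x y (not_lt.1 hv) hx.1 hy.1 hx.2 hy.2
  calc A.card ≤ (Finset.univ.biUnion fun v => (N v).image fun w => s(v, w)).card := by
        refine Finset.card_le_card fun e he => ?_
        induction e with
        | _ x y =>
          simp only [Finset.mem_biUnion, Finset.mem_univ, true_and, Finset.mem_image]
          have hy : y ∈ neighbors A x := mem_neighbors.2 he
          by_cases hx : (neighbors A x).card < D
          · exact ⟨x, y, by simpa only [N, if_pos hx] using hy, rfl⟩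
          · refine ⟨y, x, ?_, Sym2.eq_swap⟩
            by_cases hy' : (neighbors A y).card < D
            · simpa only [N, if_pos hy'] using mem_neighbors_comm.1 hy
            · simp only [N, if_neg hy', Finset.mem_filter]
              exact ⟨mem_neighbors_comm.1 hy, not_lt.1 hx⟩
    _ ≤ ∑ v, ((N v).image fun w => s(v, w)).card := Finset.card_biUnion_le
    _ ≤ ∑ _v : Fin n, D := Finset.sum_le_sum fun v _ => Finset.card_image_le.trans (hN v)
    _ = D * n := by simp [mul_comm]

/-- If at most one vertex of `Z` is big, the neighbours of the others have bounded degree, and no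
two vertices of `Z` of degree at least `m` are at distance at least three, then few vertices of `Z`
have degree at least `m`. -/
theorem card_filter_le_of_distance {A : Finset (Sym2 (Fin n))} {Z : Finset (Fin n)} {D M m : ℕ}
    (hbig : ∀ z ∈ Z, ∀ v, D ≤ (neighbors A z).card → D ≤ (neighbors A v).card → z = v)
    (hnbr : ∀ z ∈ Z, m ≤ (neighbors A z).card → (neighbors A z).card < D →
      ∀ w ∈ neighbors A z, (neighbors A w).card ≤ M)
    (hdist : ∀ z ∈ Z, ∀ v ∈ Z, m ≤ (neighbors A z).card → m ≤ (neighbors A v).card → v ≠ z →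
      v ∉ neighbors A z → Disjoint (neighbors A z) (neighbors A v) → False) :
    (Z.filter fun z => m ≤ (neighbors A z).card).card ≤ 1 + (1 + D + D * M) := by
  set T := Z.filter fun z => m ≤ (neighbors A z).card ∧ (neighbors A z).card < D with hT
  have hsub : (Z.filter fun z => m ≤ (neighbors A z).card) ⊆
      (Z.filter fun z => D ≤ (neighbors A z).card) ∪ T := fun z hz => by
    rw [Finset.mem_filter] at hz
    rw [Finset.mem_union, Finset.mem_filter, Finset.mem_filter]
    rcases lt_or_ge (neighbors A z).card D with h | h
    · exact Or.inr ⟨hz.1, hz.2, h⟩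
    · exact Or.inl ⟨hz.1, h⟩
  refine ((Finset.card_le_card hsub).trans (Finset.card_union_le _ _)).trans
    (Nat.add_le_add (card_big_le_one hbig) ?_)
  rcases T.eq_empty_or_nonempty with h | ⟨z, hz⟩
  · simp [h]
  obtain ⟨hzZ, hzm, hzD⟩ := Finset.mem_filter.1 hz
  refine (Finset.card_le_card (t := ({z} ∪ neighbors A z) ∪
    (neighbors A z).biUnion (neighbors A)) fun v hv => ?_).trans ?_
  · obtain ⟨hvZ, hvm, -⟩ := Finset.mem_filter.1 hv
    by_contra hcon
    simp only [Finset.mem_union, Finset.mem_singleton, Finset.mem_biUnion, not_or, not_exists,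
      not_and] at hcon
    refine hdist z hzZ v hvZ hzm hvm hcon.1.1 hcon.1.2 (Finset.disjoint_left.2 fun w hw hw' => ?_)
    exact hcon.2 w hw (mem_neighbors_comm.1 hw')
  · have h1 := Finset.card_union_le ({z} ∪ neighbors A z) ((neighbors A z).biUnion (neighbors A))
    have h2 := Finset.card_union_le {z} (neighbors A z)
    have h3 := Finset.card_biUnion_le_card_mul (neighbors A z) (neighbors A) M
      (hnbr z hzZ hzm hzD)
    have h4 := Nat.mul_le_mul_right M hzD.le
    rw [Finset.card_singleton] at h2
    omega

theorem insert_subset_completeBoard {A : Finset (Sym2 (Fin n))} (hA : A ⊆ completeBoard n)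
    {x y : Fin n} (hxy : x ≠ y) : insert s(x, y) A ⊆ completeBoard n :=
  Finset.insert_subset (mk_mem_completeBoard.2 hxy) hA

theorem exists_mem_neighbors_notMem {A : Finset (Sym2 (Fin n))} {w z : Fin n}
    (h : (neighbors A z).card + 1 < (neighbors A w).card) :
    ∃ x ∈ neighbors A w, x ∉ neighbors A z ∧ x ≠ z := by
  obtain ⟨x, hx, hx'⟩ := Finset.exists_mem_notMem_of_card_lt_card
    (lt_of_le_of_lt (Finset.card_insert_le z (neighbors A z)) h)
  rw [Finset.mem_insert, not_or] at hx'
  exact ⟨x, hx, hx'.2, hx'.1⟩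

theorem exists_doubleStar_subset_of_degree {A : Finset (Sym2 (Fin n))} (hA : A ⊆ completeBoard n)
    (hk : 1 ≤ k) {x y : Fin n} (hxy : s(x, y) ∈ A) (hx : k ≤ (neighbors A x).card)
    (hy : 2 * k ≤ (neighbors A y).card) : ∃ F ∈ copiesInComplete (doubleStar k) n, F ⊆ A := by
  obtain ⟨P, hP, hPk⟩ := Finset.exists_subset_card_eq (s := (neighbors A x).erase y) (n := k - 1)
    ((Nat.sub_le_sub_right hx 1).trans Finset.pred_card_le_card_erase)
  refine exists_doubleStar_subset hA hxy (hP.trans (Finset.erase_subset _ _)) hPk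
    (fun h => by simpa using hP h) ?_
  have h1 := Finset.le_card_sdiff (insert x P) (neighbors A y)
  have h2 := Finset.card_insert_le x P
  omega

/-- The threatening edge is either the central edge, joining two big vertices or two vertices of
degree at least `k - 1` at distance at least three, or a leaf edge, giving a vertex of degree `k -
1` next to a big one its missing leaf. -/
theorem isForceable_doubleStar (n : ℕ) (hk : 3 ≤ k) :
    IsForceable (copiesInComplete (doubleStar k) n) (k - 2) (2 * k)
      (1 + (1 + 2 * k + 2 * k * (2 * k))) (2 * k) := by
  have hbig : ∀ A ⊆ completeBoard n, ∀ Z, NoThreat (copiesInComplete (doubleStar k) n) A Z →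
      ∀ z ∈ Z, ∀ v, 2 * k ≤ (neighbors A z).card → 2 * k ≤ (neighbors A v).card → z = v := by
    intro A hA Z hN z hz v hzD hvD
    by_contra hzv
    have hmono := neighbors_mono (Finset.subset_insert s(z, v) A)
    obtain ⟨F, hF, hFA⟩ := exists_doubleStar_subset_of_degree (k := k)
      (insert_subset_completeBoard hA hzv) (by omega) (Finset.mem_insert_self _ _)
      (le_trans (by omega) (hzD.trans (Finset.card_le_card (hmono z))))
      (hvD.trans (Finset.card_le_card (hmono v)))
    exact hN _ (mk_mem_touching hz hzv) F hF hFA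
  refine ⟨fun A hA hF => card_le_of_big_neighbors (by omega) fun v w w' hvD hw hw' hwD hwD' => ?_,
    hbig, fun A hA Z hN => card_filter_le_of_distance (hbig A hA Z hN) ?_ ?_⟩
  · obtain ⟨F, hF', hFA⟩ := exists_doubleStar_subset_of_degree (k := k) hA (by omega)
      (mem_neighbors.1 hw) (le_trans (by omega) hvD) hwD
    exact absurd hFA (hF F hF')
  · intro z hz hzm hzD w hw
    by_contra hM
    obtain ⟨x, hxw, hxz, hne⟩ := exists_mem_neighbors_notMem (A := A) (w := w) (z := z) (by omega)
    have hmono := neighbors_mono (Finset.subset_insert s(z, x) A)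
    have hz' : k ≤ (neighbors (insert s(z, x) A) z).card := by
      have h1 : insert x (neighbors A z) ⊆ neighbors (insert s(z, x) A) z :=
        Finset.insert_subset (mem_neighbors.2 (Finset.mem_insert_self _ _)) (hmono z)
      have h2 := Finset.card_le_card h1
      rw [Finset.card_insert_of_notMem hxz] at h2
      omega
    obtain ⟨F, hF, hFA⟩ := exists_doubleStar_subset_of_degree (k := k)
      (insert_subset_completeBoard hA hne.symm) (by omega)
      (Finset.mem_insert_of_mem (mem_neighbors.1 hw)) hz'
      ((not_le.1 hM).le.trans (Finset.card_le_card (hmono w)))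
    exact hN _ (mk_mem_touching hz hne.symm) F hF hFA
  · intro z hz v hv hzm hvm hvz hvN hdisj
    have hmono := neighbors_mono (Finset.subset_insert s(z, v) A)
    obtain ⟨P, hP, hPk⟩ := Finset.exists_subset_card_eq (s := neighbors A z) (n := k - 1) (by omega)
    obtain ⟨F, hF, hFA⟩ := exists_doubleStar_subset (k := k)
      (insert_subset_completeBoard hA hvz.symm) (Finset.mem_insert_self _ _)
      (hP.trans (hmono z)) hPk (fun h => hvN (hP h)) (by
        refine le_trans (show k - 1 ≤ (neighbors A v).card by omega) (Finset.card_le_card fun w hw =>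
          Finset.mem_sdiff.2 ⟨hmono v hw, fun h => ?_⟩)
        rcases Finset.mem_insert.1 h with rfl | h
        · exact hvN (mem_neighbors_comm.1 hw)
        · exact Finset.disjoint_left.1 hdisj (hP h) hw)
    exact hN _ (mk_mem_touching hz hvz.symm) F hF hFA

/-- The leaves of `x` are chosen first. With `x` and `w` they block at most `k + 1` neighbours of
`y`, and `k - 1` of the `2 * k` survive. -/
theorem exists_pathDoubleStar_subset_of_degree {A : Finset (Sym2 (Fin n))}
    (hA : A ⊆ completeBoard n) {x w y : Fin n} (hxy : x ≠ y) (hxw : s(x, w) ∈ A)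
    (hyw : s(y, w) ∈ A) (hx : k - 1 ≤ ((neighbors A x).erase y \ {w}).card)
    (hy : 2 * k ≤ (neighbors A y).card) :
    ∃ F ∈ copiesInComplete (pathDoubleStar k) n, F ⊆ A := by
  obtain ⟨P, hP, hPk⟩ := Finset.exists_subset_card_eq hx
  refine exists_pathDoubleStar_subset hA hxy hxw hyw
    (hP.trans (Finset.sdiff_subset.trans (Finset.erase_subset _ _))) hPk
    (fun h => by simpa using hP h) (fun h => by simpa using hP h) ?_
  have h1 := Finset.le_card_sdiff (insert x (insert w P)) (neighbors A y)
  have h2 := Finset.card_insert_le x (insert w P)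
  have h3 := Finset.card_insert_le w P
  omega

theorem card_erase_sdiff_singleton_ge (N : Finset (Fin n)) (y w : Fin n) :
    N.card ≤ (N.erase y \ {w}).card + 2 := by
  have h1 := Finset.pred_card_le_card_erase (s := N) (a := y)
  have h2 := Finset.le_card_sdiff {w} (N.erase y)
  rw [Finset.card_singleton] at h2
  omega

/-- The threatening edge is always one of the two edges of the central path; both centres already
have their leaves, so degree `k` takes over the role of `k - 1`. -/
theorem isForceable_pathDoubleStar (n : ℕ) (hk : 3 ≤ k) :
    IsForceable (copiesInComplete (pathDoubleStar k) n) (k - 1) (2 * k)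
      (1 + (1 + 2 * k + 2 * k * (2 * k))) (2 * k) := by
  have hbig : ∀ A ⊆ completeBoard n, ∀ Z, NoThreat (copiesInComplete (pathDoubleStar k) n) A Z →
      ∀ z ∈ Z, ∀ v, 2 * k ≤ (neighbors A z).card → 2 * k ≤ (neighbors A v).card → z = v := by
    intro A hA Z hN z hz v hzD hvD
    by_contra hzv
    obtain ⟨w, hw⟩ : ((neighbors A v).erase z).Nonempty := by
      rw [← Finset.card_pos]
      have := Finset.pred_card_le_card_erase (s := neighbors A v) (a := z)
      omega
    obtain ⟨hwz, hwv⟩ := Finset.mem_erase.1 hw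
    have hmono := neighbors_mono (Finset.subset_insert s(z, w) A)
    obtain ⟨F, hF, hFA⟩ := exists_pathDoubleStar_subset_of_degree (k := k)
      (insert_subset_completeBoard hA hwz.symm) hzv (Finset.mem_insert_self _ _)
      (Finset.mem_insert_of_mem (mem_neighbors.1 hwv)) (by
        have h1 := card_erase_sdiff_singleton_ge (neighbors (insert s(z, w) A) z) v w
        have h2 := Finset.card_le_card (hmono z)
        omega) (hvD.trans (Finset.card_le_card (hmono v)))
    exact hN _ (mk_mem_touching hz hwz.symm) F hF hFA
  refine ⟨fun A hA hF => card_le_of_big_neighbors (by omega) fun v w w' hvD hw hw' hwD hwD' => ?_,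
    hbig, fun A hA Z hN => card_filter_le_of_distance (hbig A hA Z hN) ?_ ?_⟩
  · by_contra hne
    obtain ⟨F, hF', hFA⟩ := exists_pathDoubleStar_subset_of_degree (k := k) hA hne
      (mem_neighbors.1 (mem_neighbors_comm.1 hw)) (mem_neighbors.1 (mem_neighbors_comm.1 hw')) (by
        have h1 := card_erase_sdiff_singleton_ge (neighbors A w) w' v
        omega) hwD'
    exact hF F hF' hFA
  · intro z hz hzm hzD w hw
    by_contra hM
    -- The path will be `z`, `x`, `w`. A middle vertex not yet adjacent to `z` costs `z` none of its
    -- leaves.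
    obtain ⟨x, hxw, hxz, hne⟩ := exists_mem_neighbors_notMem (A := A) (w := w) (z := z) (by omega)
    have hmono := neighbors_mono (Finset.subset_insert s(z, x) A)
    have hzw : z ≠ w := mk_mem_completeBoard.1 (hA (mem_neighbors.1 hw))
    obtain ⟨F, hF, hFA⟩ := exists_pathDoubleStar_subset_of_degree (k := k)
      (insert_subset_completeBoard hA hne.symm) hzw (Finset.mem_insert_self _ _)
      (Finset.mem_insert_of_mem (mem_neighbors.1 hxw)) (by
        refine le_trans ((Nat.sub_le_sub_right hzm 1).trans
          (Finset.pred_card_le_card_erase (a := w))) (Finset.card_le_card fun y hy => ?_)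
        obtain ⟨hyw, hyz⟩ := Finset.mem_erase.1 hy
        refine Finset.mem_sdiff.2 ⟨Finset.mem_erase.2 ⟨hyw, hmono z hyz⟩, fun h => hxz ?_⟩
        rwa [Finset.mem_singleton.1 h] at hyz)
      ((not_le.1 hM).le.trans (Finset.card_le_card (hmono w)))
    exact hN _ (mk_mem_touching hz hne.symm) F hF hFA
  · intro z hz v hv hzm hvm hvz hvN hdisj
    -- Joining `v` to a neighbour `y` of `z` makes `y` the middle vertex; `z` keeps at least `k - 1`
    -- other neighbours as leaves.
    obtain ⟨y, hy⟩ : (neighbors A z).Nonempty := Finset.card_pos.1 (by omega)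
    have hyv : y ∉ neighbors A v := Finset.disjoint_left.1 hdisj hy
    have hvy : v ≠ y := fun h => hvN (h ▸ hy)
    have hmono := neighbors_mono (Finset.subset_insert s(v, y) A)
    obtain ⟨P, hP, hPk⟩ := Finset.exists_subset_card_eq (s := (neighbors A z).erase y) (n := k - 1)
      ((Nat.sub_le_sub_right (by omega : k ≤ _) 1).trans Finset.pred_card_le_card_erase)
    have hPz := hP.trans (Finset.erase_subset _ _)
    obtain ⟨F, hF, hFA⟩ := exists_pathDoubleStar_subset (k := k)
      (insert_subset_completeBoard hA hvy) hvz.symm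
      (Finset.mem_insert_of_mem (mem_neighbors.1 hy)) (Finset.mem_insert_self _ _)
      (hPz.trans (hmono z)) hPk (fun h => hvN (hPz h)) (fun h => by simpa using hP h) (by
        refine le_trans (show k - 1 ≤ (neighbors A v).card by omega) (Finset.card_le_card fun w hw =>
          Finset.mem_sdiff.2 ⟨hmono v hw, fun h => ?_⟩)
        rcases Finset.mem_insert.1 h with rfl | h
        · exact hvN (mem_neighbors_comm.1 hw)
        · rcases Finset.mem_insert.1 h with rfl | h
          · exact hyv hw
          · exact Finset.disjoint_left.1 hdisj (hPz h) hw)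
    exact hN _ (mk_mem_touching hv hvy) F hF hFA

theorem card_le_incidenceDegree {ι : Type*} [Fintype ι] {F : Finset (Sym2 (Fin n))} {x : Fin n}
    {g : ι → Fin n} (hg : Function.Injective g) (h : ∀ i, s(x, g i) ∈ F) :
    Fintype.card ι ≤ incidenceDegree F x := by
  refine Finset.card_le_card_of_injOn (s := Finset.univ) (fun i => s(x, g i))
    (fun i _ => ?_) fun i _ j _ hij => hg (Sym2.congr_right.1 hij)
  simpa using h i

theorem exists_mem_of_incidenceDegree_lt {A₀ F e : Finset (Sym2 (Fin n))} {x : Fin n}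
    (hF : F ⊆ A₀ ∪ e) (h : incidenceDegree A₀ x < incidenceDegree F x) :
    ∃ f ∈ F, f ∈ e ∧ x ∈ f := by
  obtain ⟨f, hf, hf'⟩ := Finset.exists_mem_notMem_of_card_lt_card h
  rw [Finset.mem_filter] at hf hf'
  refine ⟨f, hf.1, (Finset.mem_union.1 (hF hf.1)).resolve_left fun h => hf' ⟨h, hf.2⟩, hf.2⟩

theorem le_incidenceDegree_of_doubleStar (hk : 1 ≤ k) {F : Finset (Sym2 (Fin n))}
    {φ : DoubleStarVertex k ↪ Fin n}
    (hF : (F : Set (Sym2 (Fin n))) = Sym2.map φ '' (doubleStar k).edgeSet) :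
    k ≤ incidenceDegree F (φ .u) ∧ k ≤ incidenceDegree F (φ .v) := by
  have hmem : ∀ e ∈ (doubleStar k).edgeSet, Sym2.map φ e ∈ F := fun e he => by
    rw [← Finset.mem_coe, hF]
    exact ⟨e, he, rfl⟩
  have hcard : Fintype.card (Option (Fin (k - 1))) = k := by simp; omega
  constructor
  · refine hcard.symm.le.trans (card_le_incidenceDegree
      (g := fun i => φ (i.elim .v .uLeaf)) (fun i j hij => ?_) fun i => ?_)
    · have := φ.injective hij
      cases i <;> cases j <;> simp_all
    · refine hmem s(.u, i.elim .v .uLeaf) ?_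
      cases i <;> simp [doubleStar]
  · refine hcard.symm.le.trans (card_le_incidenceDegree
      (g := fun i => φ (i.elim .u .vLeaf)) (fun i j hij => ?_) fun i => ?_)
    · have := φ.injective hij
      cases i <;> cases j <;> simp_all
    · refine hmem s(.v, i.elim .u .vLeaf) ?_
      cases i <;> simp [doubleStar]

theorem le_incidenceDegree_of_pathDoubleStar (hk : 1 ≤ k) {F : Finset (Sym2 (Fin n))}
    {φ : PathDoubleStarVertex k ↪ Fin n}
    (hF : (F : Set (Sym2 (Fin n))) = Sym2.map φ '' (pathDoubleStar k).edgeSet) :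
    k ≤ incidenceDegree F (φ .u) ∧ k ≤ incidenceDegree F (φ .v) := by
  have hmem : ∀ e ∈ (pathDoubleStar k).edgeSet, Sym2.map φ e ∈ F := fun e he => by
    rw [← Finset.mem_coe, hF]
    exact ⟨e, he, rfl⟩
  have hcard : Fintype.card (Option (Fin (k - 1))) = k := by simp; omega
  constructor
  · refine hcard.symm.le.trans (card_le_incidenceDegree
      (g := fun i => φ (i.elim .w .uLeaf)) (fun i j hij => ?_) fun i => ?_)
    · have := φ.injective hij
      cases i <;> cases j <;> simp_all
    · refine hmem s(.u, i.elim .w .uLeaf) ?_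
      cases i <;> simp [pathDoubleStar]
  · refine hcard.symm.le.trans (card_le_incidenceDegree
      (g := fun i => φ (i.elim .w .vLeaf)) (fun i j hij => ?_) fun i => ?_)
    · have := φ.injective hij
      cases i <;> cases j <;> simp_all
    · refine hmem s(.v, i.elim .w .vLeaf) ?_
      cases i <;> simp [pathDoubleStar]

theorem not_doubleStar_subset_union (hk : 3 ≤ k) {F : Finset (Sym2 (Fin n))}
    (hF : F ∈ copiesInComplete (doubleStar k) n) {A₀ e : Finset (Sym2 (Fin n))}
    (hA₀ : ∀ v, incidenceDegree A₀ v ≤ k - 2) (he : e.card ≤ 1) : ¬ F ⊆ A₀ ∪ e := by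
  intro hFA
  obtain ⟨φ, hφ⟩ := hF
  have h1 := (le_incidenceDegree_of_doubleStar (by omega) hφ).1
  have h2 := hA₀ (φ .u)
  have h3 : incidenceDegree F (φ .u) ≤ incidenceDegree A₀ (φ .u) + e.card := by
    unfold incidenceDegree
    refine (Finset.card_le_card (Finset.filter_subset_filter _ hFA)).trans ?_
    rw [Finset.filter_union]
    exact (Finset.card_union_le _ _).trans (Nat.add_le_add_left (Finset.card_filter_le _ _) _)
  omega

theorem not_pathDoubleStar_subset_union (hk : 3 ≤ k) {F : Finset (Sym2 (Fin n))}
    (hF : F ∈ copiesInComplete (pathDoubleStar k) n) {A₀ e : Finset (Sym2 (Fin n))}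
    (hA₀ : ∀ v, incidenceDegree A₀ v ≤ k - 1) (he : e.card ≤ 1) : ¬ F ⊆ A₀ ∪ e := by
  intro hFA
  obtain ⟨φ, hφ⟩ := hF
  obtain ⟨hu, hv⟩ := le_incidenceDegree_of_pathDoubleStar (by omega) hφ
  -- Both centres have degree at least `k` in `F`, so each lies on the single extra edge. That edge
  -- would then join them, which no edge of the target does.
  obtain ⟨f, hfF, hfe, hfu⟩ := exists_mem_of_incidenceDegree_lt hFA
    (lt_of_le_of_lt (hA₀ (φ .u)) (by omega))
  obtain ⟨g, -, hge, hgv⟩ := exists_mem_of_incidenceDegree_lt hFA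
    (lt_of_le_of_lt (hA₀ (φ .v)) (by omega))
  obtain rfl := Finset.card_le_one.1 he f hfe g hge
  rw [← Finset.mem_coe, hφ] at hfF
  obtain ⟨d, hd, rfl⟩ := hfF
  obtain ⟨x, hx, hxu⟩ := Sym2.mem_map.1 hfu
  obtain ⟨y, hy, hyv⟩ := Sym2.mem_map.1 hgv
  rw [φ.injective hxu] at hx
  rw [φ.injective hyv] at hy
  obtain rfl := (Sym2.mem_and_mem_iff (by simp)).1 ⟨hx, hy⟩
  simp [pathDoubleStar] at hd

end Copies

/-! ### From the two strategies to the order of the threshold -/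

section Threshold

theorem exists_quota_le (D C j : ℕ) :
    ∃ c, ∀ t, quota t D C j ≤ c * (t + 1) ^ (j + 1) := by
  induction j with
  | zero => exact ⟨D * (C + 2), fun t => by rw [quota]; apply le_of_eq; ring⟩
  | succ j ih =>
    obtain ⟨c, hc⟩ := ih
    refine ⟨D * (c + 3), fun t => ?_⟩
    have h1 : t + 1 ≤ (t + 1) ^ (j + 1) := Nat.le_self_pow (by omega) _
    have h2 : quota t D C j + t + 3 ≤ (c + 3) * (t + 1) ^ (j + 1) := by
      have := hc t
      rw [add_mul]
      omega
    calc quota t D C (j + 1) ≤ (t + 1) * D * ((c + 3) * (t + 1) ^ (j + 1)) :=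
          Nat.mul_le_mul_left _ h2
      _ = _ := by ring

theorem exists_four_mul_quota_le (D C j : ℕ) :
    ∃ c, 0 < c ∧ ∀ t, 1 ≤ t → 4 * quota t D C j ≤ c * t ^ (j + 1) := by
  obtain ⟨c, hc⟩ := exists_quota_le D C j
  refine ⟨4 * (c * 2 ^ (j + 1)) + 1, by omega, fun t ht => ?_⟩
  calc 4 * quota t D C j ≤ 4 * (c * (t + 1) ^ (j + 1)) := Nat.mul_le_mul_left _ (hc t)
    _ ≤ 4 * (c * (2 * t) ^ (j + 1)) := by gcongr; omega
    _ = 4 * (c * 2 ^ (j + 1)) * t ^ (j + 1) := by rw [mul_pow]; ring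
    _ ≤ _ := Nat.mul_le_mul_right _ (by omega)

variable {L D C K : ℕ} {𝓕 : ∀ n, Set (Finset (Sym2 (Fin n)))} {f : ℕ → ℕ}

theorem isBigO_of_avoider
    (hf : ∀ n, IsMonotoneThresholdBias (completeBoard n) (𝓕 n) (f n))
    (hav : ∀ n b, 0 < b → 2 ^ L * n ^ (L + 2) ≤ b ^ (L + 1) →
      ¬ EnforcerWinsMonotone (completeBoard n) (𝓕 n) 1 b) :
    (fun n : ℕ => (f n : ℝ)) =O[atTop]
      (fun n : ℕ => (n : ℝ) ^ (((L : ℝ) + 2) / ((L : ℝ) + 1))) := by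
  refine IsBigO.of_bound 3 ((eventually_ge_atTop 1).mono fun n hn => ?_)
  set x : ℝ := (n : ℝ) ^ (((L : ℝ) + 2) / ((L : ℝ) + 1)) with hx
  have hn' : (1 : ℝ) ≤ n := by exact_mod_cast hn
  have hx1 : 1 ≤ x := Real.one_le_rpow hn' (by positivity)
  have hxL : x ^ (L + 1) = (n : ℝ) ^ (L + 2) := by
    rw [hx, ← Real.rpow_natCast, ← Real.rpow_mul (by positivity), ← Real.rpow_natCast]
    congr 1
    push_cast
    field_simp
  have hb0 : 0 < ⌈2 * x⌉₊ := Nat.ceil_pos.2 (by linarith)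
  have hb : 2 ^ L * n ^ (L + 2) ≤ ⌈2 * x⌉₊ ^ (L + 1) := by
    have h1 : (2 * x) ^ (L + 1) ≤ (⌈2 * x⌉₊ : ℝ) ^ (L + 1) :=
      pow_le_pow_left₀ (by linarith) (Nat.le_ceil _) _
    rw [mul_pow, hxL, pow_succ] at h1
    have h2 : (0 : ℝ) ≤ 2 ^ L * (n : ℝ) ^ (L + 2) := by positivity
    have h3 : (2 : ℝ) ^ L * (n : ℝ) ^ (L + 2) ≤ (⌈2 * x⌉₊ : ℝ) ^ (L + 1) := by linarith
    exact_mod_cast h3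
  have h1 : f n < ⌈2 * x⌉₊ := by
    by_contra hle
    exact hav n _ hb0 hb ((hf n _ hb0).2 (not_lt.1 hle))
  have h2 : (f n : ℝ) < 2 * x + 1 :=
    (Nat.cast_lt.2 h1).trans (Nat.ceil_lt_add_one (by linarith))
  rw [Real.norm_of_nonneg (by positivity), Real.norm_of_nonneg (by linarith)]
  linarith

theorem isBigO_of_isForceable (hLD : L < D) (h𝓕 : ∀ n, IsForceable (𝓕 n) L D C K)
    (hf : ∀ n, IsMonotoneThresholdBias (completeBoard n) (𝓕 n) (f n)) :
    (fun n : ℕ => (n : ℝ) ^ (((L : ℝ) + 2) / ((L : ℝ) + 1))) =O[atTop]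
      (fun n : ℕ => (f n : ℝ)) := by
  obtain ⟨c, hc, hquota⟩ := exists_four_mul_quota_le D C L
  have hc' : (0 : ℝ) < c := by exact_mod_cast hc
  set β : ℝ := 1 / ((L : ℝ) + 1) with hβ
  have hβ0 : 0 < β := by positivity
  have hlim : Tendsto (fun n : ℕ => ((n : ℝ) / c) ^ β) atTop atTop :=
    (tendsto_rpow_atTop hβ0).comp (tendsto_natCast_atTop_atTop.atTop_div_const hc')
  refine IsBigO.of_bound (32 * (c : ℝ) ^ β) ?_
  filter_upwards [hlim.eventually_ge_atTop (8 * (K + 1) : ℝ), eventually_ge_atTop 2] with n hs hn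
  set s : ℝ := ((n : ℝ) / c) ^ β with hs'
  have hn' : (2 : ℝ) ≤ n := by exact_mod_cast hn
  have hn0 : (0 : ℝ) < n := by linarith
  have hK : (0 : ℝ) ≤ K := Nat.cast_nonneg K
  have hs0 : 0 ≤ s := by linarith
  have hsL : s ^ (L + 1) = (n : ℝ) / c := by
    rw [hs', ← Real.rpow_natCast, ← Real.rpow_mul (by positivity), hβ]
    push_cast
    rw [one_div, inv_mul_cancel₀ (by positivity), Real.rpow_one]
  have ht8 : 8 * (K + 1) ≤ ⌊s⌋₊ := Nat.le_floor (by exact_mod_cast hs)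
  set t := ⌊s⌋₊ with ht
  have htn : c * t ^ (L + 1) ≤ n := by
    have h1 : (t : ℝ) ^ (L + 1) ≤ (n : ℝ) / c :=
      hsL ▸ pow_le_pow_left₀ (Nat.cast_nonneg t) (Nat.floor_le hs0) _
    rw [le_div_iff₀ hc'] at h1
    rw [mul_comm]
    exact_mod_cast h1
  have htn8 : 8 * (K + 1) * n ≤ t * n := Nat.mul_le_mul_right n ht8
  have hexp : 8 * (K + 1) * n = 8 * (K * n) + 8 * n := by ring
  have hhalf : t * n ≤ 4 * (t * (n / 2)) := by
    rw [mul_left_comm]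
    exact Nat.mul_le_mul_left t (by omega)
  have hwin : EnforcerWinsMonotone (completeBoard n) (𝓕 n) 1 (t * n / 8) :=
    enforcerWinsMonotone_of_isForceable (t := t) (h𝓕 n) hLD (by omega) (by omega)
      ((hquota t (by omega)).trans htn)
  have hle : t * n / 8 ≤ f n := (hf n _ (by omega)).1 hwin
  have hle' : t * n ≤ 16 * f n := by omega
  have hle'' : (t : ℝ) * n ≤ 16 * f n := by exact_mod_cast hle'
  have hst : s ≤ 2 * t := by
    have h1 := Nat.lt_floor_add_one s
    have h2 : (1 : ℝ) ≤ t := by exact_mod_cast (by omega : 1 ≤ t)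
    rw [← ht] at h1
    linarith
  have hx : (n : ℝ) ^ (((L : ℝ) + 2) / ((L : ℝ) + 1)) = (c : ℝ) ^ β * (s * n) := by
    have h1 : ((L : ℝ) + 2) / ((L : ℝ) + 1) = β + 1 := by rw [hβ]; field_simp; ring
    rw [h1, Real.rpow_add hn0, Real.rpow_one, hs', Real.div_rpow hn0.le hc'.le]
    have : (c : ℝ) ^ β ≠ 0 := (Real.rpow_pos_of_pos hc' _).ne'
    field_simp
  rw [Real.norm_of_nonneg (by positivity), Real.norm_of_nonneg (by positivity), hx,
    mul_comm (32 : ℝ), mul_assoc]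
  refine mul_le_mul_of_nonneg_left ?_ (by positivity)
  nlinarith

theorem exists_threshold_isTheta (hLD : L < D) (h𝓕 : ∀ n, IsForceable (𝓕 n) L D C K)
    (hav : ∀ n b, 0 < b → 2 ^ L * n ^ (L + 2) ≤ b ^ (L + 1) →
      ¬ EnforcerWinsMonotone (completeBoard n) (𝓕 n) 1 b) :
    ∃ f : ℕ → ℕ, (∀ n, IsMonotoneThresholdBias (completeBoard n) (𝓕 n) (f n)) ∧
      (fun n : ℕ => (f n : ℝ)) =Θ[atTop]
        (fun n : ℕ => (n : ℝ) ^ (((L : ℝ) + 2) / ((L : ℝ) + 1))) := by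
  have hex : ∀ n, ∃ m, IsMonotoneThresholdBias (completeBoard n) (𝓕 n) m := fun n =>
    exists_isMonotoneThresholdBias (b₀ := 2 ^ L * n ^ (L + 2) + 1) (by omega)
      (hav n _ (by omega) ((Nat.le_succ _).trans (Nat.le_self_pow (by omega) _)))
  choose f hf using hex
  exact ⟨f, hf, isBigO_of_avoider hf hav, isBigO_of_isForceable hLD h𝓕 hf⟩

end Threshold

theorem theorem2 (k : ℕ) (hk : 3 ≤ k) :
    (∃ f : ℕ → ℕ,
      (∀ n : ℕ, IsMonotoneThresholdBias (completeBoard n)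
        (copiesInComplete (doubleStar k) n) (f n)) ∧
      (fun n : ℕ => (f n : ℝ)) =Θ[atTop]
        (fun n : ℕ => (n : ℝ) ^ ((k : ℝ) / ((k : ℝ) - 1)))) ∧
    (∃ f : ℕ → ℕ,
      (∀ n : ℕ, IsMonotoneThresholdBias (completeBoard n)
        (copiesInComplete (pathDoubleStar k) n) (f n)) ∧
      (fun n : ℕ => (f n : ℝ)) =Θ[atTop]
        (fun n : ℕ => (n : ℝ) ^ (((k : ℝ) + 1) / (k : ℝ)))) := by
  constructor
  · have h := exists_threshold_isTheta (by omega) (fun n => isForceable_doubleStar n hk)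
      fun n b hb0 hb => not_enforcerWinsMonotone_of_bounded_degree (by omega) hb0 hb
        fun F hF A₀ e hA₀ he => not_doubleStar_subset_union hk hF hA₀ he
    have h1 : (((k - 2 : ℕ) : ℝ) + 2) / (((k - 2 : ℕ) : ℝ) + 1) = (k : ℝ) / ((k : ℝ) - 1) := by
      rw [Nat.cast_sub (by omega)]
      push_cast
      ring_nf
    rwa [h1] at h
  · have h := exists_threshold_isTheta (by omega) (fun n => isForceable_pathDoubleStar n hk)
      fun n b hb0 hb => not_enforcerWinsMonotone_of_bounded_degree (by omega) hb0 hb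
        fun F hF A₀ e hA₀ he => not_pathDoubleStar_subset_union hk hF hA₀ he
    have h1 : (((k - 1 : ℕ) : ℝ) + 2) / (((k - 1 : ℕ) : ℝ) + 1) = ((k : ℝ) + 1) / (k : ℝ) := by
      rw [Nat.cast_sub (by omega)]
      push_cast
      ring_nf
    rwa [h1] at h
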